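/- Let $(\Omega,\mathcal F,\mathcal F_t,X_t,\theta_t,\mathbb P_x)$ be a time-homogeneous strong Markov process on $\mathbb R$ with càdlàg paths and right-continuous filtration, $\mathbb P_x(X_0=x)=1$, such that for every starting point $x\in\mathbb R$ $$\limsup_{t\to\infty}X_t=\infty\quad\text{and}\quad\liminf_{t\to\infty}X_t=-\infty\qquad \mathbb P_x\text{-a.s.}$$ Let $b\in\mathbb R$, $\tau^b:=\inf\{t\ge0: X_t\le b\}$, $\sigma^b:=\inf\{t\ge0: X_t\ge b\}$, and assume $\mathbb P_x(X_{\tau^b}=b)=0$ for all $x>b$ and $\mathbb P_x(X_{\sigma^b}=b)=0$ for all $x<b$. Put $\sigma_0:=0$ and, for $n\ge1$, $$\tau_n:=\inf\{t\ge\sigma_{n-1}: X_t<b\},\qquad \sigma_n:=\inf\{t\ge\tau_n: X_t>b\},$$ and let $Y_n:=X_{\sigma_n}$, $n\ge0$ (for a start $x\ne b$ all these times are a.s. finite). 1. If $\mathbb P_x(\lim_{n\to\infty}Y_n=\infty)=1$ for all $x>b$ and there exist $r,R>0$ and $c<1$ such that $$\sup_{y\in[b-r,b+r],\,y\ne b}\mathbb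 P_y(X_{\sigma_1}>b+R)<c,$$ then $b$ is locally transient, i.e. $\mathbb P_b(\liminf_{t\to\infty}|X_t-b|=0)<1$. 2. If $\mathbb P_x(\liminf_{n\to\infty}Y_n=b)=1$ for all $x>b$, then $b$ is locally recurrent, i.e. $\mathbb P_b(\liminf_{t\to\infty}|X_t-b|=0)=1$. 3. If $\mathbb P_x(\lim_{n\to\infty}Y_n=b)=1$ for all $x>b$ and there exist $r',R'>0$ and $c<1$ such that $$\sup_{y\ge b+r'}\mathbb P_y(X_{\sigma_1}<b+R')<c,$$ then $b$ is left limit recurrent, i.e. $\mathbb P_b(\forall T>0\ \exists t>T:\ X_{t-}=b)=1$. -/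

import Mathlib

open MeasureTheory Filter Topology Set
open scoped NNReal ENNReal

noncomputable section

namespace Overshoot

/-- The σ-algebra on `Ω` generated by all the variables `X t`, `t ≥ 0`. -/
abbrev pathSigma {Ω : Type*} (X : ℝ≥0 → Ω → ℝ) : MeasurableSpace Ω :=
  ⨆ t, MeasurableSpace.comap (X t) inferInstance

/-- A path `[0,∞) → ℝ` which is right continuous with (finite) left limits. -/
def IsCadlag (f : ℝ≥0 → ℝ) : Prop :=
  (∀ t, ContinuousWithinAt f (Ici t) t) ∧ ∀ t, ∃ l : ℝ, Tendsto f (𝓝[<] t) (𝓝 l)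

/-- A time homogeneous strong Markov process `(Ω, 𝓕, 𝓕 t, X t, θ t, P x)` on `ℝ` with càdlàg
paths and a right continuous filtration. The ambient σ-algebra on `Ω` and the filtration may be
larger than the ones generated by `X` (for instance completed). -/
structure StrongMarkovProcess (Ω : Type*) [mΩ : MeasurableSpace Ω] where
  /-- the filtration -/
  𝓕 : Filtration ℝ≥0 mΩ
  /-- the process -/
  X : ℝ≥0 → Ω → ℝ
  /-- the shift operators -/
  θ : ℝ≥0 → Ω → Ω
  /-- the law of the process started in `x` -/
  P : ℝ → Measure Ω
  rightContinuous : 𝓕.IsRightContinuous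
  adapted : Adapted 𝓕 X
  cadlag : ∀ ω, IsCadlag fun t => X t ω
  shift : ∀ s t ω, X s (θ t ω) = X (t + s) ω
  isProbabilityMeasure : ∀ x, IsProbabilityMeasure (P x)
  start : ∀ x, ∀ᵐ ω ∂P x, X 0 ω = x
  measurable_law : ∀ G, MeasurableSet[pathSigma X] G → Measurable fun x => P x G
  /-- For every stopping time `τ` and every event `G` of the path, on `{τ < ∞}`,
  `P x (θ_τ ∈ G | 𝓕_τ) = P (X_τ) (G)`; this is written in integrated form, over all events `A`
  of the σ-algebra `𝓕_τ`. -/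
  strongMarkov : ∀ (x : ℝ) (τ : Ω → WithTop ℝ≥0) (hτ : IsStoppingTime 𝓕 τ) (A G : Set Ω),
    MeasurableSet[hτ.measurableSpace] A → MeasurableSet[pathSigma X] G →
      P x (A ∩ {ω | τ ω ≠ ⊤ ∧ θ (τ ω).untopA ω ∈ G}) =
        ∫⁻ ω in A ∩ {ω | τ ω ≠ ⊤}, P (stoppedValue X τ ω) G ∂P x

/-- `inf {t ≥ σ | X t ∈ A}`, where `σ` is a random time; equal to `∞` if there is no such `t`
(in particular if `σ = ∞`). -/
def entryAfter {Ω : Type*} (X : ℝ≥0 → Ω → ℝ) (A : Set ℝ) (σ : Ω → WithTop ℝ≥0) :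
    Ω → WithTop ℝ≥0 :=
  open scoped Classical in
  fun ω => if σ ω = ⊤ then ⊤ else hittingAfter X A (σ ω).untopA ω

namespace StrongMarkovProcess

variable {Ω : Type*} [MeasurableSpace Ω] (M : StrongMarkovProcess Ω)

/-- Almost surely `limsup X t = ∞` and `liminf X t = -∞` as `t → ∞`, whatever the starting
point. -/
def Oscillating : Prop :=
  ∀ x, ∀ᵐ ω ∂M.P x, limsup (fun t => (M.X t ω : EReal)) atTop = ⊤ ∧
    liminf (fun t => (M.X t ω : EReal)) atTop = ⊥

/-- The process started in `x > b` a.s. does not enter `(-∞, b]` by hitting `b`, and started in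
`x < b` it a.s. does not enter `[b, ∞)` by hitting `b`. -/
def EntersWithoutHitting (b : ℝ) : Prop :=
  (∀ x, b < x → M.P x {ω | hittingAfter M.X (Iic b) 0 ω ≠ ⊤ ∧
    stoppedValue M.X (hittingAfter M.X (Iic b) 0) ω = b} = 0) ∧
  (∀ x, x < b → M.P x {ω | hittingAfter M.X (Ici b) 0 ω ≠ ⊤ ∧
    stoppedValue M.X (hittingAfter M.X (Ici b) 0) ω = b} = 0)

/-- `σ 0 = 0` and `σ (n+1) = inf {t ≥ τ (n+1) | X t > b}`, where
`τ (n+1) = inf {t ≥ σ n | X t < b}`. -/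
def σ (b : ℝ) : ℕ → Ω → WithTop ℝ≥0
  | 0 => fun _ => 0
  | n + 1 => entryAfter M.X (Ioi b) (entryAfter M.X (Iio b) (σ b n))

/-- The upward overshoots `Y n = X (σ n)`; the value has no meaning where `σ n = ∞`, which has
probability zero for an oscillating process. -/
def Y (b : ℝ) (n : ℕ) : Ω → ℝ := stoppedValue M.X (M.σ b n)

/-- `P b (liminf |X t - b| = 0) = 1`. -/
def LocallyRecurrent (b : ℝ) : Prop :=
  ∀ᵐ ω ∂M.P b, liminf (fun t => ((|M.X t ω - b| : ℝ) : EReal)) atTop = 0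

/-- `P b (liminf |X t - b| = 0) < 1`. -/
def LocallyTransient (b : ℝ) : Prop :=
  M.P b {ω | liminf (fun t => ((|M.X t ω - b| : ℝ) : EReal)) atTop = 0} < 1

/-- `P b`-almost surely, the left limit of `X` equals `b` at arbitrarily large times. -/
def LeftLimitRecurrent (b : ℝ) : Prop :=
  ∀ᵐ ω ∂M.P b, ∀ T : ℝ≥0, 0 < T → ∃ t, T < t ∧ Tendsto (fun s => M.X s ω) (𝓝[<] t) (𝓝 b)

end StrongMarkovProcess

end Overshoot

end

/-! The heart is a contraction argument, `measure_overshootsIn_visitsOften_eq_zero`. Fix a set `V`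
and a set `U` exhausted by open sets `U j`. Let `p z` be the probability, from `z`, that every
overshoot over `b` lands in `V` and that `U` is visited at arbitrarily late times; this event is
inherited by all later paths. Let `s` be the supremum of `p` over the closures of the `U j`. Waiting
for the entry into `U j` shows `p ≤ s` everywhere. If the first overshoot from those closures lands
in `V` with probability at most `c < 1`, the strong Markov property at the first upcrossing gives `p
≤ s * c` there. So `s ≤ s * c`, and `s = 0`.

Local transience: take `V = (b + R, ∞)` and for `U` a punctured ball around `b`. When `Y n → ∞` the
crossing times are unbounded, because along bounded times a càdlàg path has a finite limit; so from
some crossing on all overshoots are in `V`, and late visits to `U` are excluded. Late visits to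
every ball around `b` would then force the path to rest at `b` during an interval, which
`false_of_constant` rules out, since `b` is not hit between crossings.

Left limit recurrence: take `V = (-∞, b + R')` and `U = (b + r', ∞)`, which is visited by
oscillation. When `Y n → b`, unbounded crossing times would produce the null event, so they have a
finite supremum, where the left limit is `lim Y n = b`.

Local recurrence only uses that some `Y n` is close to `b`. These arguments start above `b`;
`Oscillating.ae_exists_shiftPath` carries them to the start `b`, and past any given time, by waiting
for a visit above `b + 1`. Path events are written with the countably many times `dseq` to make them
measurable for the σ-algebra of the path. -/

noncomputable section

namespace Overshoot

/-! ### Entry times of a path -/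

/-- The first time from `t` on at which the path `f` is in `A`. -/
def entry (f : ℝ≥0 → ℝ) (A : Set ℝ) (t : WithTop ℝ≥0) : WithTop ℝ≥0 :=
  sInf ((↑) '' {u : ℝ≥0 | t ≤ u ∧ f u ∈ A})

/-- The path `f` with the time origin moved to `t`. -/
def shiftPath (t : ℝ≥0) (f : ℝ≥0 → ℝ) : ℝ≥0 → ℝ := fun s => f (t + s)

/-- The path is right continuous at each time. -/
def RightCts (f : ℝ≥0 → ℝ) : Prop := ∀ t, ContinuousWithinAt f (Ici t) t

/-- The times at which the path completes its upcrossings of the level `b`. -/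
def upTime (f : ℝ≥0 → ℝ) (b : ℝ) : ℕ → WithTop ℝ≥0
  | 0 => 0
  | n + 1 => entry f (Ioi b) (entry f (Iio b) (upTime f b n))

/-- The sequence of times used to write path events with countably many coordinates. -/
abbrev dseq : ℕ → ℝ≥0 := TopologicalSpace.denseSeq ℝ≥0

section

variable {f : ℝ≥0 → ℝ} {A : Set ℝ} {b : ℝ} {s t : WithTop ℝ≥0} {u v : ℝ≥0}

lemma entry_lt_iff : entry f A t < s ↔ ∃ u : ℝ≥0, t ≤ u ∧ (u : WithTop ℝ≥0) < s ∧ f u ∈ A := by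
  unfold entry
  rw [sInf_lt_iff]
  constructor
  · rintro ⟨_, ⟨u, ⟨h1, h2⟩, rfl⟩, h⟩
    exact ⟨u, h1, h, h2⟩
  · rintro ⟨u, h1, h, h2⟩
    exact ⟨_, ⟨u, ⟨h1, h2⟩, rfl⟩, h⟩

lemma entry_le_coe (h : t ≤ u) (hu : f u ∈ A) : entry f A t ≤ u :=
  sInf_le ⟨u, ⟨h, hu⟩, rfl⟩

lemma le_entry : t ≤ entry f A t := by
  apply le_sInf
  rintro _ ⟨u, ⟨h, -⟩, rfl⟩
  exact h

lemma entry_mono (h : s ≤ t) : entry f A s ≤ entry f A t :=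
  sInf_le_sInf (image_mono fun _ hu => ⟨h.trans hu.1, hu.2⟩)

lemma entry_anti {B : Set ℝ} (h : A ⊆ B) : entry f B t ≤ entry f A t :=
  sInf_le_sInf (image_mono fun _ hu => ⟨hu.1, h hu.2⟩)

lemma notMem_of_lt_entry (h : t ≤ u) (hu : (u : WithTop ℝ≥0) < entry f A t) : f u ∉ A :=
  fun hA => (entry_le_coe h hA).not_gt hu

/-- Nothing of `A` is met between `s` and `t`. This identifies entries from intermediate times with
crossing times. -/
lemma entry_eq_entry (h : s ≤ t) (ht : t ≤ entry f A s) : entry f A t = entry f A s := by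
  refine le_antisymm (le_sInf ?_) (entry_mono h)
  rintro _ ⟨u, ⟨h1, h2⟩, rfl⟩
  exact entry_le_coe (ht.trans (entry_le_coe h1 h2)) h2

lemma entry_ne_top (h : ∃ u : ℝ≥0, t ≤ u ∧ f u ∈ A) : entry f A t ≠ ⊤ := by
  obtain ⟨u, h1, h2⟩ := h
  exact ne_top_of_le_ne_top (WithTop.coe_ne_top) (entry_le_coe h1 h2)

lemma entry_top : entry f A ⊤ = ⊤ := top_le_iff.1 le_entry

/-- The additive form avoids truncated subtraction and stays true when both sides are `⊤`. -/
lemma entry_shiftPath (t : ℝ≥0) (s : WithTop ℝ≥0) :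
    t + entry (shiftPath t f) A s = entry f A (t + s) := by
  refine le_antisymm (le_sInf ?_) ?_
  · rintro _ ⟨u, ⟨h1, h2⟩, rfl⟩
    have htu : t ≤ u := by
      have : (t : WithTop ℝ≥0) ≤ u := le_trans le_self_add h1
      exact_mod_cast this
    obtain ⟨w, rfl⟩ := exists_add_of_le htu
    have hsw : s ≤ w := by
      induction s with
      | top =>
        exact absurd (top_le_iff.1 (by rwa [WithTop.add_top] at h1)) (WithTop.coe_ne_top (a := t + w))
      | coe s =>
        have h1 : t + s ≤ t + w := by exact_mod_cast h1
        exact_mod_cast le_of_add_le_add_left h1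
    have := entry_le_coe (f := shiftPath t f) (A := A) hsw h2
    push_cast
    gcongr
  · have key : ∀ w : ℝ≥0, s ≤ w → shiftPath t f w ∈ A → entry f A (t + s) ≤ ((t + w : ℝ≥0)) := by
      intro w hw hA
      refine entry_le_coe ?_ hA
      push_cast
      gcongr
    induction he : entry f A (t + s) with
    | top =>
      have : entry (shiftPath t f) A s = ⊤ := by
        refine top_le_iff.1 (le_sInf ?_)
        rintro _ ⟨w, ⟨h1, h2⟩, rfl⟩
        exact absurd (top_le_iff.1 (he ▸ key w h1 h2)) WithTop.coe_ne_top
      rw [this, WithTop.add_top]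
    | coe e =>
      have : ((e - t : ℝ≥0) : WithTop ℝ≥0) ≤ entry (shiftPath t f) A s := by
        refine le_sInf ?_
        rintro _ ⟨w, ⟨h1, h2⟩, rfl⟩
        have h3 := key w h1 h2
        rw [he] at h3
        have h3 : e ≤ t + w := by exact_mod_cast h3
        exact_mod_cast tsub_le_iff_left.2 h3
      calc (e : WithTop ℝ≥0) ≤ ((t + (e - t) : ℝ≥0)) := by exact_mod_cast le_add_tsub
        _ = t + ((e - t : ℝ≥0) : WithTop ℝ≥0) := by push_cast; rfl
        _ ≤ _ := by gcongr

lemma RightCts.exists_Ico (hf : RightCts f) (hA : IsOpen A) (hu : f u ∈ A) :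
    ∃ v, u < v ∧ ∀ w ∈ Ico u v, f w ∈ A := by
  have := (hf u).eventually (hA.mem_nhds hu)
  rw [eventually_iff, mem_nhdsGE_iff_exists_Ico_subset] at this
  obtain ⟨v, h1, h2⟩ := this
  exact ⟨v, h1, fun w hw => h2 hw⟩

lemma exists_dseq_between (h : u < v) : ∃ n, u < dseq n ∧ dseq n < v := by
  obtain ⟨_, ⟨n, rfl⟩, h⟩ := (TopologicalSpace.denseRange_denseSeq ℝ≥0).exists_between h
  exact ⟨n, h⟩

/-- Right continuity keeps the path in the open set for a while, and this interval contains a time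
of the dense sequence. Hence countably many coordinates detect visits to open sets. -/
lemma RightCts.exists_dseq (hf : RightCts f) (hA : IsOpen A) (hu : f u ∈ A) (huv : u < v) :
    ∃ n, u < dseq n ∧ dseq n < v ∧ f (dseq n) ∈ A := by
  obtain ⟨w, h1, h2⟩ := hf.exists_Ico hA hu
  obtain ⟨n, h3, h4⟩ := exists_dseq_between (lt_min h1 huv)
  exact ⟨n, h3, h4.trans_le (min_le_right _ _), h2 _ ⟨h3.le, h4.trans_le (min_le_left _ _)⟩⟩

lemma RightCts.shift (hf : RightCts f) (t : ℝ≥0) : RightCts (shiftPath t f) := by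
  intro s
  refine (hf (t + s)).comp (by fun_prop) fun w hw => ?_
  simp only [mem_Ici] at hw ⊢
  gcongr

/-- The value at a finite entry time is in the closure. -/
lemma RightCts.mem_closure_of_entry (hf : RightCts f) (h : entry f A t = u) :
    f u ∈ closure A := by
  by_contra hu
  obtain ⟨v, h1, h2⟩ := hf.exists_Ico isClosed_closure.isOpen_compl hu
  have : entry f A t < v := by rw [h]; exact_mod_cast h1
  obtain ⟨w, h3, h4, h5⟩ := entry_lt_iff.1 this
  have h6 : (u : WithTop ℝ≥0) ≤ w := h ▸ entry_le_coe h3 h5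
  exact h2 w ⟨by exact_mod_cast h6, by exact_mod_cast h4⟩ (subset_closure h5)

lemma upTime_le_succ (n : ℕ) : upTime f b n ≤ upTime f b (n + 1) :=
  le_entry.trans le_entry

lemma monotone_upTime : Monotone (upTime f b) := monotone_nat_of_le_succ upTime_le_succ

/-- If the upcrossing times increase to infinity, each time from the `m`-th one on lies between two
consecutive ones. -/
lemma exists_upTime_le_lt (hub : ∀ T : ℝ≥0, ∃ n, (T : WithTop ℝ≥0) < upTime f b n) {m : ℕ}
    (hu : upTime f b m ≤ u) : ∃ n ≥ m, upTime f b n ≤ u ∧ u < upTime f b (n + 1) := by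
  classical
  have hex := hub u
  obtain ⟨k, hk⟩ : ∃ k, Nat.find hex = m + 1 + k := by
    refine exists_add_of_le (Nat.succ_le_of_lt ?_)
    by_contra! h
    exact ((Nat.find_spec hex).trans_le (monotone_upTime h)).not_ge hu
  refine ⟨m + k, by omega, ?_, ?_⟩
  · exact not_lt.1 (Nat.find_min hex (m := m + k) (by omega))
  · have := Nat.find_spec hex
    rwa [hk, show m + 1 + k = m + k + 1 by omega] at this

/-! ### Events of a path -/

/-- From a time in `dseq` with the path below `b`, the next entry above `b` takes place in `V`. -/
def OvershootsIn (b : ℝ) (V : Set ℝ) (f : ℝ≥0 → ℝ) : Prop :=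
  ∀ n, f (dseq n) < b → entry f (Ioi b) (dseq n) ≠ ⊤ ∧ f (entry f (Ioi b) (dseq n)).untopA ∈ V

/-- The path visits `U` at arbitrarily large times of `dseq`. -/
def VisitsOften (U : Set ℝ) (f : ℝ≥0 → ℝ) : Prop :=
  ∀ N : ℕ, ∃ n, (N : ℝ≥0) ≤ dseq n ∧ f (dseq n) ∈ U

/-- The path does not take the value `b` at a time of `dseq` before it gets out of `A`. -/
def AvoidsIn (b : ℝ) (A : Set ℝ) (f : ℝ≥0 → ℝ) : Prop :=
  ∀ n, (∀ k, dseq k ≤ dseq n → f (dseq k) ∈ A) → f (dseq n) ≠ b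

/-- At the entry into `A` after time `0` the path takes a value in `A`. -/
def EntersIn (A : Set ℝ) (f : ℝ≥0 → ℝ) : Prop :=
  entry f A 0 = ⊤ ∨ f (entry f A 0).untopA ∈ A

/-- A path below `b` at `s` stays there up to some time of `dseq`, and the next entry above `b` is
the same from both times. -/
lemma RightCts.overshootsIn_iff (hf : RightCts f) {V : Set ℝ} : OvershootsIn b V f ↔
    ∀ s : ℝ≥0, f s < b → ∃ u : ℝ≥0, entry f (Ioi b) s = u ∧ f u ∈ V := by
  constructor
  · intro h s hs
    obtain ⟨v, hsv, hv⟩ := hf.exists_Ico isOpen_Iio hs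
    obtain ⟨n, h1, h2⟩ := exists_dseq_between hsv
    obtain ⟨h3, h4⟩ := h n (hv _ ⟨h1.le, h2⟩)
    have : entry f (Ioi b) (dseq n) = entry f (Ioi b) s := by
      refine entry_eq_entry (by exact_mod_cast h1.le) (le_sInf ?_)
      rintro _ ⟨w, ⟨h5, h6⟩, rfl⟩
      by_contra! hlt
      have h7 : w < dseq n := by exact_mod_cast hlt
      have h8 : f w < b := hv w ⟨by exact_mod_cast h5, h7.trans h2⟩
      exact lt_asymm h8 h6
    rw [this] at h3 h4
    exact ⟨_, ((WithTop.untopA_eq_untop h3) ▸ WithTop.coe_untop _ h3).symm, h4⟩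
  · intro h n hn
    obtain ⟨u, h1, h2⟩ := h _ hn
    rw [h1]
    exact ⟨WithTop.coe_ne_top, h2⟩

lemma RightCts.visitsOften_iff (hf : RightCts f) {U : Set ℝ} (hU : IsOpen U) : VisitsOften U f ↔
    ∀ T : ℝ≥0, ∃ u, T ≤ u ∧ f u ∈ U := by
  constructor
  · intro h T
    obtain ⟨N, hN⟩ := exists_nat_ge T
    obtain ⟨n, h1, h2⟩ := h N
    exact ⟨_, hN.trans h1, h2⟩
  · intro h N
    obtain ⟨u, h1, h2⟩ := h N
    obtain ⟨n, h3, -, h5⟩ := hf.exists_dseq hU h2 (lt_add_one u)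
    exact ⟨n, h1.trans h3.le, h5⟩

/-- The event concerns all starting times, so it survives a shift; this lets the strong Markov
property reproduce it. -/
lemma RightCts.overshootsIn_shiftPath (hf : RightCts f) {V : Set ℝ} (h : OvershootsIn b V f)
    (t : ℝ≥0) : OvershootsIn b V (shiftPath t f) := by
  rw [hf.overshootsIn_iff] at h
  rw [(hf.shift t).overshootsIn_iff]
  intro s hs
  obtain ⟨u, h1, h2⟩ := h (t + s) hs
  push_cast at h1
  rw [← entry_shiftPath] at h1
  induction he : entry (shiftPath t f) (Ioi b) s with
  | top => rw [he, WithTop.add_top] at h1; exact absurd h1.symm WithTop.coe_ne_top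
  | coe e =>
    rw [he] at h1
    have h1 : t + e = u := by exact_mod_cast h1
    exact ⟨e, rfl, by rw [← h1] at h2; exact h2⟩

lemma RightCts.visitsOften_shiftPath (hf : RightCts f) {U : Set ℝ} (hU : IsOpen U)
    (h : VisitsOften U f) (t : ℝ≥0) : VisitsOften U (shiftPath t f) := by
  rw [hf.visitsOften_iff hU] at h
  rw [(hf.shift t).visitsOften_iff hU]
  intro T
  obtain ⟨u, h1, h2⟩ := h (t + T)
  obtain ⟨w, rfl⟩ := exists_add_of_le h1
  exact ⟨T + w, le_self_add, by simpa [shiftPath, add_assoc] using h2⟩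

/-- If all overshoots from the `m`-th one on are in `V`, then from the `m`-th upcrossing time on the
path overshoots in `V`. -/
lemma RightCts.overshootsIn_of_upTime (hf : RightCts f) {V : Set ℝ}
    (hub : ∀ T : ℝ≥0, ∃ n, (T : WithTop ℝ≥0) < upTime f b n) {m : ℕ}
    (hfin : ∀ n, upTime f b n ≠ ⊤)
    (hV : ∀ n ≥ m, f (upTime f b n).untopA ∈ V) {t : ℝ≥0} (ht : upTime f b m = t) :
    OvershootsIn b V (shiftPath t f) := by
  rw [(hf.shift t).overshootsIn_iff]
  intro s hs
  obtain ⟨n, hnm, h1, h2⟩ := exists_upTime_le_lt hub (m := m) (u := t + s)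
    (by rw [ht]; exact_mod_cast le_self_add)
  have h3 : entry f (Ioi b) (t + s : ℝ≥0) = upTime f b (n + 1) :=
    entry_eq_entry (entry_le_coe h1 hs) h2.le
  have h4 := hV (n + 1) (by omega)
  have h5 := hfin (n + 1)
  rw [← h3] at h4 h5
  push_cast at h4 h5
  rw [← entry_shiftPath] at h4 h5
  induction he : entry (shiftPath t f) (Ioi b) s with
  | top => rw [he, WithTop.add_top] at h5; exact absurd rfl h5
  | coe e =>
    rw [he, ← WithTop.coe_add] at h4
    exact ⟨e, rfl, h4⟩

/-- If the path stays at `b` for a while after `t`, then one of the paths between two crossings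
does so. -/
lemma false_of_constant
    (hub : ∀ T : ℝ≥0, ∃ n, (T : WithTop ℝ≥0) < upTime f b n)
    (habove : ∀ (n : ℕ) (t : ℝ≥0), upTime f b n = t → AvoidsIn b (Ici b) (shiftPath t f))
    (hbelow : ∀ (n : ℕ) (t : ℝ≥0), entry f (Iio b) (upTime f b n) = t →
      AvoidsIn b (Iic b) (shiftPath t f))
    (huv : u < v) (hc : ∀ w ∈ Ico u v, f w = b) : False := by
  -- The interval of constancy contains a time of `dseq`, at which the value is `b` while the path
  -- since `t` has not left `A`.
  have key : ∀ (A : Set ℝ) (t : ℝ≥0), t ≤ u → AvoidsIn b A (shiftPath t f) → b ∈ A →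
      (∀ w, t ≤ w → w ≤ u → f w ∈ A) → False := by
    intro A t htu hav hbA hA
    obtain ⟨x, rfl⟩ := exists_add_of_le htu
    obtain ⟨y, rfl⟩ := exists_add_of_le huv.le
    obtain ⟨n, h1, h2⟩ := exists_dseq_between (show x < x + y by
      rw [add_assoc] at huv; exact lt_of_add_lt_add_left huv)
    refine hav n (fun k hk => ?_) (hc _ ⟨by gcongr, by rw [add_assoc]; gcongr⟩)
    rcases le_or_gt (dseq k) x with h | h
    · exact hA _ le_self_add (by gcongr)
    · have : f (t + dseq k) = b := hc _ ⟨by gcongr, by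
        rw [add_assoc]; exact add_lt_add_right (hk.trans_lt h2) t⟩
      simpa [shiftPath, this] using hbA
  obtain ⟨n, -, h1, h2⟩ := exists_upTime_le_lt hub (m := 0) (u := u) (WithTop.coe_le_coe.2 zero_le)
  rcases lt_or_ge (u : WithTop ℝ≥0) (entry f (Iio b) (upTime f b n)) with h | h
  · obtain ⟨t, ht, htu⟩ := WithTop.le_coe_iff.1 h1
    refine key (Ici b) t htu (habove n t ht) self_mem_Ici fun w h3 h4 => ?_
    have := notMem_of_lt_entry (f := f) (A := Iio b) (t := upTime f b n) (u := w)
      (by rw [ht]; exact_mod_cast h3) ((WithTop.coe_le_coe.2 h4).trans_lt h)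
    simpa using this
  · obtain ⟨t, ht, htu⟩ := WithTop.le_coe_iff.1 h
    refine key (Iic b) t htu (hbelow n t ht) self_mem_Iic fun w h3 h4 => ?_
    have := notMem_of_lt_entry (f := f) (A := Ioi b) (t := t) (u := w)
      (by exact_mod_cast h3) ((WithTop.coe_le_coe.2 h4).trans_lt (by rw [← ht]; exact h2))
    simpa using this

end

/-! ### Measurability of entry times and path events -/

lemma coe_untopA {t : WithTop ℝ≥0} (h : t ≠ ⊤) : ((t.untopA : ℝ≥0) : WithTop ℝ≥0) = t := by
  rw [WithTop.untopA_eq_untop h, WithTop.coe_untop]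

lemma hittingAfter_eq_entry {Ω : Type*} (X : ℝ≥0 → Ω → ℝ) (A : Set ℝ) (n : ℝ≥0) (ω : Ω) :
    hittingAfter X A n ω = entry (X · ω) A n := by
  refine eq_of_forall_gt_iff fun c => ?_
  rw [entry_lt_iff]
  induction c with
  | top =>
    rw [lt_top_iff_ne_top, Ne, hittingAfter_eq_top_iff]
    push Not
    simp only [WithTop.coe_le_coe, WithTop.coe_lt_top, true_and]
  | coe c =>
    rw [hittingAfter_lt_iff]
    simp only [WithTop.coe_le_coe, WithTop.coe_lt_coe, mem_Ico, and_assoc]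

lemma entryAfter_eq_entry {Ω : Type*} (X : ℝ≥0 → Ω → ℝ) (A : Set ℝ) (τ : Ω → WithTop ℝ≥0) (ω : Ω) :
    entryAfter X A τ ω = entry (X · ω) A (τ ω) := by
  unfold entryAfter
  split_ifs with h
  · rw [h, entry_top]
  · rw [hittingAfter_eq_entry, coe_untopA h]

section

variable {Ω : Type*} {m : MeasurableSpace Ω} {X : ℝ≥0 → Ω → ℝ}

lemma entry_lt_coe_iff {f : ℝ≥0 → ℝ} (hf : RightCts f) {U : Set ℝ} (hU : IsOpen U)
    {s : WithTop ℝ≥0} {t : ℝ≥0} :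
    entry f U s < t ↔ ∃ n, dseq n < t ∧ s ≤ dseq n ∧ f (dseq n) ∈ U := by
  rw [entry_lt_iff]
  constructor
  · rintro ⟨u, h1, h2, h3⟩
    obtain ⟨n, h4, h5, h6⟩ := hf.exists_dseq hU h3 (by exact_mod_cast h2 : u < t)
    exact ⟨n, h5, h1.trans (by exact_mod_cast h4.le), h6⟩
  · rintro ⟨n, h1, h2, h3⟩
    exact ⟨_, h2, by exact_mod_cast h1, h3⟩

/-- For open `U`, the event that the entry is strictly before `t` is a countable union of events
known before `t`. Right continuity of the filtration turns strict into weak inequalities. -/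
lemma isStoppingTime_entry {𝓕 : Filtration ℝ≥0 m} [𝓕.IsRightContinuous] (hX : Adapted 𝓕 X)
    (hc : ∀ ω, RightCts (X · ω)) {U : Set ℝ} (hU : IsOpen U) {τ : Ω → WithTop ℝ≥0}
    (hτ : IsStoppingTime 𝓕 τ) : IsStoppingTime 𝓕 fun ω => entry (X · ω) U (τ ω) := by
  refine isStoppingTime_of_measurableSet_lt_of_isRightContinuous fun t => ?_
  have : {ω | entry (X · ω) U (τ ω) < t} =
      ⋃ n, ⋃ (_ : dseq n < t), {ω | τ ω ≤ dseq n} ∩ X (dseq n) ⁻¹' U := by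
    ext ω
    simp only [mem_ofPred_eq, entry_lt_coe_iff (hc ω) hU, mem_iUnion, mem_inter_iff, mem_preimage,
      exists_prop]
  rw [this]
  refine MeasurableSet.iUnion fun n => MeasurableSet.iUnion fun hn => 𝓕.mono hn.le _ ?_
  exact (hτ (dseq n)).inter (hX (dseq n) hU.measurableSet)

lemma measurable_entry (hX : ∀ t, Measurable (X t)) (hc : ∀ ω, RightCts (X · ω)) {U : Set ℝ}
    (hU : IsOpen U) {τ : Ω → WithTop ℝ≥0} (hτ : Measurable τ) :
    Measurable fun ω => entry (X · ω) U (τ ω) := by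
  refine measurable_of_Iio fun t => ?_
  induction t with
  | top =>
    have : (fun ω => entry (X · ω) U (τ ω)) ⁻¹' Iio ⊤ =
        ⋃ n, {ω | τ ω ≤ dseq n} ∩ X (dseq n) ⁻¹' U := by
      ext ω
      simp only [mem_preimage, mem_Iio, entry_lt_iff, mem_iUnion, mem_inter_iff, mem_ofPred_eq]
      constructor
      · rintro ⟨u, h1, -, h3⟩
        obtain ⟨n, h4, -, h6⟩ := (hc ω).exists_dseq hU h3 (lt_add_one u)
        exact ⟨n, h1.trans (by exact_mod_cast h4.le), h6⟩
      · rintro ⟨n, h1, h2⟩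
        exact ⟨_, h1, WithTop.coe_lt_top _, h2⟩
    rw [this]
    exact .iUnion fun n => (measurableSet_le hτ measurable_const).inter (hX _ hU.measurableSet)
  | coe t =>
    have : (fun ω => entry (X · ω) U (τ ω)) ⁻¹' Iio (t : WithTop ℝ≥0) =
        ⋃ n, ⋃ (_ : dseq n < t), {ω | τ ω ≤ dseq n} ∩ X (dseq n) ⁻¹' U := by
      ext ω
      simp only [mem_preimage, mem_Iio, entry_lt_coe_iff (hc ω) hU, mem_iUnion, mem_inter_iff,
        mem_ofPred_eq, exists_prop]
    rw [this]
    exact .iUnion fun n => .iUnion fun _ =>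
      (measurableSet_le hτ measurable_const).inter (hX _ hU.measurableSet)

/-- The next point of the grid of mesh `1 / (n + 1)`: the approximation must come from the right,
where the paths are continuous. -/
lemma tendsto_floor_add_one_div_nhdsGE (t : ℝ≥0) :
    Tendsto (fun n : ℕ => ((⌊((n : ℝ≥0) + 1) * t⌋₊ : ℝ≥0) + 1) / ((n : ℝ≥0) + 1)) atTop
      (𝓝[≥] t) := by
  have hpos : ∀ n : ℕ, (0 : ℝ≥0) < n + 1 := fun n => by positivity
  have h1 : ∀ n : ℕ, t ≤ ((⌊((n : ℝ≥0) + 1) * t⌋₊ : ℝ≥0) + 1) / ((n : ℝ≥0) + 1) := fun n => by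
    rw [le_div_iff₀ (hpos n), mul_comm]
    exact (Nat.lt_floor_add_one _).le
  have h2 : ∀ n : ℕ, ((⌊((n : ℝ≥0) + 1) * t⌋₊ : ℝ≥0) + 1) / ((n : ℝ≥0) + 1) ≤
      t + 1 / ((n : ℝ≥0) + 1) := fun n => by
    rw [div_le_iff₀ (hpos n), add_mul t, one_div, inv_mul_cancel₀ (hpos n).ne', mul_comm t]
    gcongr
    exact Nat.floor_le zero_le
  refine tendsto_nhdsWithin_iff.2 ⟨?_, Eventually.of_forall h1⟩
  refine tendsto_of_tendsto_of_tendsto_of_le_of_le tendsto_const_nhds ?_ h1 h2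
  simpa using (tendsto_const_nhds (x := t)).add
    (tendsto_one_div_add_atTop_nhds_zero_nat (𝕜 := ℝ≥0))

lemma measurable_uncurry_comp_of_nat (hX : ∀ t, Measurable (X t)) (φ : ℕ → ℝ≥0) {κ : ℝ≥0 → ℕ}
    (hκ : Measurable κ) : Measurable fun p : ℝ≥0 × Ω => X (φ (κ p.1)) p.2 := by
  have h1 : Measurable fun q : ℕ × Ω => X (φ q.1) q.2 :=
    measurable_from_prod_countable_right fun k => hX (φ k)
  exact h1.comp ((hκ.comp measurable_fst).prodMk measurable_snd)

/-- The process read at the discretised times is jointly measurable, as these take countably many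
values, and it converges to `X`. -/
lemma measurable_uncurry_of_rightCts (hX : ∀ t, Measurable (X t)) (hc : ∀ ω, RightCts (X · ω)) :
    Measurable fun p : ℝ≥0 × Ω => X p.1 p.2 := by
  have hm : ∀ n : ℕ, Measurable fun p : ℝ≥0 × Ω =>
      X (((⌊((n : ℝ≥0) + 1) * p.1⌋₊ : ℝ≥0) + 1) / ((n : ℝ≥0) + 1)) p.2 := fun n =>
    measurable_uncurry_comp_of_nat hX (fun k => ((k : ℝ≥0) + 1) / ((n : ℝ≥0) + 1))
      (κ := fun t => ⌊((n : ℝ≥0) + 1) * t⌋₊)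
      (Nat.measurable_floor.comp (measurable_id.const_mul _))
  have ht : ∀ p : ℝ≥0 × Ω, Tendsto (fun n : ℕ =>
      X (((⌊((n : ℝ≥0) + 1) * p.1⌋₊ : ℝ≥0) + 1) / ((n : ℝ≥0) + 1)) p.2) atTop (𝓝 (X p.1 p.2)) :=
    fun p => Tendsto.comp (g := (X · p.2)) (hc p.2 p.1) (tendsto_floor_add_one_div_nhdsGE p.1)
  exact measurable_of_tendsto_metrizable hm (tendsto_pi_nhds.2 ht)

lemma measurable_apply_untopA (hX : ∀ t, Measurable (X t)) (hc : ∀ ω, RightCts (X · ω))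
    {τ : Ω → WithTop ℝ≥0} (hτ : Measurable τ) : Measurable fun ω => X (τ ω).untopA ω :=
  (measurable_uncurry_of_rightCts hX hc).comp (hτ.untopA.prodMk measurable_id)

lemma measurableSet_overshootsIn (hX : ∀ t, Measurable (X t)) (hc : ∀ ω, RightCts (X · ω))
    {b : ℝ} {V : Set ℝ} (hV : MeasurableSet V) :
    MeasurableSet {ω | OvershootsIn b V (X · ω)} := by
  refine measurableSet_setOfPred.2 (Measurable.forall fun n => Measurable.imp ?_ (Measurable.and ?_ ?_))
  · exact measurableSet_setOfPred.1 (measurableSet_lt (hX _) measurable_const)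
  · refine Measurable.not (measurableSet_setOfPred.1 ?_)
    exact measurable_entry hX hc isOpen_Ioi measurable_const (measurableSet_singleton _)
  · exact measurableSet_setOfPred.1 (measurable_apply_untopA hX hc
      (measurable_entry hX hc isOpen_Ioi measurable_const) hV)

lemma measurableSet_visitsOften (hX : ∀ t, Measurable (X t)) {U : Set ℝ} (hU : MeasurableSet U) :
    MeasurableSet {ω | VisitsOften U (X · ω)} := by
  refine measurableSet_setOfPred.2 (Measurable.forall fun N => Measurable.exists fun n =>
    Measurable.and measurable_const ?_)
  exact measurableSet_setOfPred.1 (hX _ hU)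

lemma measurableSet_avoidsIn (hX : ∀ t, Measurable (X t)) {b : ℝ} {A : Set ℝ}
    (hA : MeasurableSet A) : MeasurableSet {ω | AvoidsIn b A (X · ω)} := by
  refine measurableSet_setOfPred.2 (Measurable.forall fun n => Measurable.imp
    (Measurable.forall fun k => Measurable.imp measurable_const ?_) (Measurable.not ?_))
  · exact measurableSet_setOfPred.1 (hX _ hA)
  · exact measurableSet_setOfPred.1 (hX _ (measurableSet_singleton b))

lemma measurableSet_entersIn (hX : ∀ t, Measurable (X t)) (hc : ∀ ω, RightCts (X · ω))
    {A : Set ℝ} (hA : IsOpen A) : MeasurableSet {ω | EntersIn A (X · ω)} := by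
  have := measurable_entry hX hc hA (τ := fun _ => 0) measurable_const
  exact (this (measurableSet_singleton ⊤)).union
    (measurable_apply_untopA hX hc this hA.measurableSet)

lemma measurable_upTime (hX : ∀ t, Measurable (X t)) (hc : ∀ ω, RightCts (X · ω)) (b : ℝ) (n : ℕ) :
    Measurable fun ω => upTime (X · ω) b n := by
  induction n with
  | zero => exact measurable_const
  | succ n ih =>
    exact measurable_entry hX hc isOpen_Ioi (measurable_entry hX hc isOpen_Iio ih)

end

namespace StrongMarkovProcess

/-! ### The strong Markov property for path events -/

variable {Ω : Type*} [MeasurableSpace Ω] (M : StrongMarkovProcess Ω)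

instance (x : ℝ) : IsProbabilityMeasure (M.P x) := M.isProbabilityMeasure x

instance : M.𝓕.IsRightContinuous := M.rightContinuous

lemma rightCts (ω : Ω) : RightCts (M.X · ω) := (M.cadlag ω).1

lemma measurable_X (t : ℝ≥0) : Measurable (M.X t) :=
  (M.adapted t).mono (M.𝓕.le t) le_rfl

lemma measurable_X_pathSigma (t : ℝ≥0) : Measurable[pathSigma M.X] (M.X t) :=
  (comap_measurable (M.X t)).mono
    (le_iSup (fun t => MeasurableSpace.comap (M.X t) inferInstance) t) le_rfl

lemma sigma_eq_upTime (b : ℝ) (n : ℕ) (ω : Ω) : M.σ b n ω = upTime (M.X · ω) b n := by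
  induction n with
  | zero => rfl
  | succ n ih => simp only [σ, upTime, entryAfter_eq_entry, ih]

lemma isStoppingTime_entry {U : Set ℝ} (hU : IsOpen U) {τ : Ω → WithTop ℝ≥0}
    (hτ : IsStoppingTime M.𝓕 τ) : IsStoppingTime M.𝓕 fun ω => entry (M.X · ω) U (τ ω) :=
  Overshoot.isStoppingTime_entry M.adapted M.rightCts hU hτ

lemma isStoppingTime_upTime (b : ℝ) (n : ℕ) :
    IsStoppingTime M.𝓕 fun ω => upTime (M.X · ω) b n := by
  induction n with
  | zero => exact isStoppingTime_const _ 0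
  | succ n ih => exact M.isStoppingTime_entry isOpen_Ioi (M.isStoppingTime_entry isOpen_Iio ih)

/-- The strong Markov property for an event `p` of the path after the stopping time `τ`. -/
lemma measure_shiftPath {τ : Ω → WithTop ℝ≥0} (hτ : IsStoppingTime M.𝓕 τ)
    {p : (ℝ≥0 → ℝ) → Prop} (hp : MeasurableSet[pathSigma M.X] {ω | p (M.X · ω)}) (x : ℝ) :
    M.P x {ω | τ ω ≠ ⊤ ∧ p (shiftPath (τ ω).untopA (M.X · ω))} =
      ∫⁻ ω in {ω | τ ω ≠ ⊤}, M.P (M.X (τ ω).untopA ω) {ω | p (M.X · ω)} ∂M.P x := by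
  have := M.strongMarkov x τ hτ univ _ .univ hp
  simp only [univ_inter, mem_ofPred_eq, M.shift] at this
  exact this

/-- The strong Markov identity for the complementary event has an integrand that vanishes almost
everywhere. -/
lemma ae_shiftPath {τ : Ω → WithTop ℝ≥0} (hτ : IsStoppingTime M.𝓕 τ)
    {p : (ℝ≥0 → ℝ) → Prop} (hp : MeasurableSet[pathSigma M.X] {ω | p (M.X · ω)}) {x : ℝ}
    (h : ∀ᵐ ω ∂M.P x, τ ω ≠ ⊤ → ∀ᵐ ω' ∂M.P (M.X (τ ω).untopA ω), p (M.X · ω')) :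
    ∀ᵐ ω ∂M.P x, τ ω ≠ ⊤ → p (shiftPath (τ ω).untopA (M.X · ω)) := by
  have h0 : MeasurableSet {ω | τ ω ≠ ⊤} := hτ.measurableSet_eq_top.compl
  have h1 := M.measure_shiftPath hτ (p := fun f => ¬ p f) hp.compl x
  replace h1 := h1.trans (lintegral_eq_zero_of_ae_eq_zero ((ae_restrict_iff' h0).2 h))
  filter_upwards [measure_eq_zero_iff_ae_notMem.1 h1] with ω hω hτω
  by_contra h2
  exact hω ⟨hτω, h2⟩

/-! ### Consequences of not hitting `b` and of oscillation -/

variable {M}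

/-- From above, the value at the entry into `(-∞, b]` is at most `b` and not `b`, so this is already
the entry into `(-∞, b)`. From below, the entry is at time `0`. -/
lemma EntersWithoutHitting.ae_entersIn_Iio {b : ℝ} (hb : M.EntersWithoutHitting b) {x : ℝ}
    (hx : x ≠ b) : ∀ᵐ ω ∂M.P x, EntersIn (Iio b) (M.X · ω) := by
  rcases hx.lt_or_gt with hx | hx
  · filter_upwards [M.start x] with ω hω
    have h0 : entry (M.X · ω) (Iio b) 0 = (0 : ℝ≥0) :=
      le_antisymm (entry_le_coe le_rfl (by simpa [hω] using hx)) bot_le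
    right
    rw [h0]
    change M.X 0 ω < b
    rwa [hω]
  · filter_upwards [measure_eq_zero_iff_ae_notMem.1 (hb.1 x hx)] with ω hω
    by_cases h : entry (M.X · ω) (Iio b) 0 = ⊤
    · exact .inl h
    right
    have h1 : entry (M.X · ω) (Iic b) 0 ≤ entry (M.X · ω) (Iio b) 0 :=
      entry_anti Iio_subset_Iic_self
    have h2 : entry (M.X · ω) (Iic b) 0 ≠ ⊤ := ne_top_of_le_ne_top h h1
    have h3 := (M.rightCts ω).mem_closure_of_entry (coe_untopA h2).symm
    rw [isClosed_Iic.closure_eq] at h3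
    simp only [stoppedValue, hittingAfter_eq_entry, WithTop.coe_zero, not_and] at hω
    have h4 := lt_of_le_of_ne h3 (hω h2)
    have h5 : entry (M.X · ω) (Iio b) 0 = entry (M.X · ω) (Iic b) 0 := by
      refine le_antisymm ?_ h1
      rw [← coe_untopA h2]
      exact entry_le_coe bot_le h4
    rw [h5]
    exact h4

lemma EntersWithoutHitting.ae_entersIn_Ioi {b : ℝ} (hb : M.EntersWithoutHitting b) {x : ℝ}
    (hx : x < b) : ∀ᵐ ω ∂M.P x, EntersIn (Ioi b) (M.X · ω) := by
  filter_upwards [measure_eq_zero_iff_ae_notMem.1 (hb.2 x hx)] with ω hω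
  by_cases h : entry (M.X · ω) (Ioi b) 0 = ⊤
  · exact .inl h
  right
  have h1 : entry (M.X · ω) (Ici b) 0 ≤ entry (M.X · ω) (Ioi b) 0 :=
    entry_anti Ioi_subset_Ici_self
  have h2 : entry (M.X · ω) (Ici b) 0 ≠ ⊤ := ne_top_of_le_ne_top h h1
  have h3 := (M.rightCts ω).mem_closure_of_entry (coe_untopA h2).symm
  rw [isClosed_Ici.closure_eq] at h3
  simp only [stoppedValue, hittingAfter_eq_entry, WithTop.coe_zero, not_and] at hω
  have h4 := lt_of_le_of_ne h3 (Ne.symm (hω h2))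
  have h5 : entry (M.X · ω) (Ioi b) 0 = entry (M.X · ω) (Ici b) 0 := by
    refine le_antisymm ?_ h1
    rw [← coe_untopA h2]
    exact entry_le_coe bot_le h4
  rw [h5]
  exact h4

/-- A value `b` at a time of `dseq` means that `(-∞, b]` was entered by then. The entry value is
strictly below `b`, so the entry was strictly earlier, and right continuity gives a still earlier
time of `dseq` outside `[b, ∞)`. -/
lemma EntersWithoutHitting.ae_avoidsIn_Ici {b : ℝ} (hb : M.EntersWithoutHitting b) {x : ℝ}
    (hx : b < x) : ∀ᵐ ω ∂M.P x, AvoidsIn b (Ici b) (M.X · ω) := by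
  filter_upwards [measure_eq_zero_iff_ae_notMem.1 (hb.1 x hx)] with ω hω n hn hnb
  simp only [stoppedValue, hittingAfter_eq_entry, WithTop.coe_zero, not_and] at hω
  have h1 : entry (M.X · ω) (Iic b) 0 ≤ dseq n := entry_le_coe bot_le hnb.le
  have h2 : entry (M.X · ω) (Iic b) 0 ≠ ⊤ := ne_top_of_le_ne_top WithTop.coe_ne_top h1
  have h3 := (M.rightCts ω).mem_closure_of_entry (coe_untopA h2).symm
  rw [isClosed_Iic.closure_eq] at h3
  have h4 := lt_of_le_of_ne h3 (hω h2)
  rw [← coe_untopA h2] at h1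
  have h5 := lt_of_le_of_ne (WithTop.coe_le_coe.1 h1) fun h => hω h2 (by rw [h]; exact hnb)
  obtain ⟨k, -, h7, h8⟩ := (M.rightCts ω).exists_dseq isOpen_Iio h4 h5
  exact (mem_Ici.1 (hn k h7.le)).not_gt (mem_Iio.1 h8)

lemma EntersWithoutHitting.ae_avoidsIn_Iic {b : ℝ} (hb : M.EntersWithoutHitting b) {x : ℝ}
    (hx : x < b) : ∀ᵐ ω ∂M.P x, AvoidsIn b (Iic b) (M.X · ω) := by
  filter_upwards [measure_eq_zero_iff_ae_notMem.1 (hb.2 x hx)] with ω hω n hn hnb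
  simp only [stoppedValue, hittingAfter_eq_entry, WithTop.coe_zero, not_and] at hω
  have h1 : entry (M.X · ω) (Ici b) 0 ≤ dseq n := entry_le_coe bot_le hnb.ge
  have h2 : entry (M.X · ω) (Ici b) 0 ≠ ⊤ := ne_top_of_le_ne_top WithTop.coe_ne_top h1
  have h3 := (M.rightCts ω).mem_closure_of_entry (coe_untopA h2).symm
  rw [isClosed_Ici.closure_eq] at h3
  have h4 := lt_of_le_of_ne h3 (Ne.symm (hω h2))
  rw [← coe_untopA h2] at h1
  have h5 := lt_of_le_of_ne (WithTop.coe_le_coe.1 h1) fun h => hω h2 (by rw [h]; exact hnb)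
  obtain ⟨k, -, h7, h8⟩ := (M.rightCts ω).exists_dseq isOpen_Ioi h4 h5
  exact (mem_Iic.1 (hn k h7.le)).not_gt (mem_Ioi.1 h8)

lemma frequently_gt_of_limsup {g : ℝ≥0 → ℝ} (h : limsup (fun t => (g t : EReal)) atTop = ⊤)
    (T : ℝ≥0) (c : ℝ) : ∃ t, T ≤ t ∧ c < g t := by
  have h1 : (c : EReal) < limsup (fun t => (g t : EReal)) atTop := h ▸ EReal.coe_lt_top c
  obtain ⟨t, h2, h3⟩ := frequently_atTop.1 (frequently_lt_of_lt_limsup (by isBoundedDefault) h1) T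
  exact ⟨t, h2, by exact_mod_cast h3⟩

lemma frequently_lt_of_liminf {g : ℝ≥0 → ℝ} (h : liminf (fun t => (g t : EReal)) atTop = ⊥)
    (T : ℝ≥0) (c : ℝ) : ∃ t, T ≤ t ∧ g t < c := by
  have h1 : liminf (fun t => (g t : EReal)) atTop < c := h ▸ EReal.bot_lt_coe c
  obtain ⟨t, h2, h3⟩ := frequently_atTop.1 (frequently_lt_of_liminf_lt (by isBoundedDefault) h1) T
  exact ⟨t, h2, by exact_mod_cast h3⟩

lemma Oscillating.ae_exists (hosc : M.Oscillating) (x : ℝ) : ∀ᵐ ω ∂M.P x, ∀ (T : ℝ≥0) (c : ℝ),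
    (∃ t, T ≤ t ∧ c < M.X t ω) ∧ ∃ t, T ≤ t ∧ M.X t ω < c := by
  filter_upwards [hosc x] with ω hω T c
  exact ⟨frequently_gt_of_limsup hω.1 T c, frequently_lt_of_liminf hω.2 T c⟩

lemma entry_ne_top_of_forall {f : ℝ≥0 → ℝ} {A : Set ℝ} (h : ∀ T : ℝ≥0, ∃ t, T ≤ t ∧ f t ∈ A)
    {s : WithTop ℝ≥0} (hs : s ≠ ⊤) : entry f A s ≠ ⊤ := by
  obtain ⟨t, h1, h2⟩ := h s.untopA
  refine entry_ne_top ⟨t, ?_, h2⟩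
  rw [← coe_untopA hs]
  exact_mod_cast h1

lemma upTime_ne_top {f : ℝ≥0 → ℝ} {b : ℝ} (h1 : ∀ T : ℝ≥0, ∃ t, T ≤ t ∧ b < f t)
    (h2 : ∀ T : ℝ≥0, ∃ t, T ≤ t ∧ f t < b) (n : ℕ) : upTime f b n ≠ ⊤ := by
  induction n with
  | zero => exact WithTop.coe_ne_top (a := 0)
  | succ n ih => exact entry_ne_top_of_forall h1 (entry_ne_top_of_forall h2 ih)

end StrongMarkovProcess

/-! ### Overshoots along the crossings -/

lemma EntersIn.apply_entry {f : ℝ≥0 → ℝ} {A : Set ℝ} {t : WithTop ℝ≥0} (ht : t ≠ ⊤)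
    (h : EntersIn A (shiftPath t.untopA f)) (he : entry f A t ≠ ⊤) :
    f (entry f A t).untopA ∈ A := by
  have h1 := entry_shiftPath (f := f) (A := A) t.untopA 0
  rw [add_zero, coe_untopA ht] at h1
  rcases h with h | h
  · rw [h, WithTop.add_top] at h1
    exact absurd h1.symm he
  · induction h2 : entry (shiftPath t.untopA f) A 0 with
    | top =>
      rw [h2, WithTop.add_top] at h1
      exact absurd h1.symm he
    | coe e =>
      have h3 : entry f A t = ((t.untopA + e : ℝ≥0) : WithTop ℝ≥0) := by
        rw [← h1, h2, WithTop.coe_add, coe_untopA ht]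
      rw [h2] at h
      rw [h3]
      exact h

namespace StrongMarkovProcess

variable {Ω : Type*} [MeasurableSpace Ω] {M : StrongMarkovProcess Ω} {b : ℝ}

lemma ae_apply_entry_mem {τ : Ω → WithTop ℝ≥0} (hτ : IsStoppingTime M.𝓕 τ) {A : Set ℝ}
    (hA : IsOpen A) {x : ℝ}
    (h : ∀ᵐ ω ∂M.P x, τ ω ≠ ⊤ → ∀ᵐ ω' ∂M.P (M.X (τ ω).untopA ω), EntersIn A (M.X · ω')) :
    ∀ᵐ ω ∂M.P x, τ ω ≠ ⊤ → entry (M.X · ω) A (τ ω) ≠ ⊤ →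
      M.X (entry (M.X · ω) A (τ ω)).untopA ω ∈ A := by
  filter_upwards [M.ae_shiftPath hτ
    (measurableSet_entersIn M.measurable_X_pathSigma M.rightCts hA) h] with ω hω h1 h2
  exact (hω h1).apply_entry h1 h2

/-- Started above `b`, the process is strictly above `b` at each upcrossing time and strictly below
`b` at each downcrossing time. -/
lemma EntersWithoutHitting.ae_crossing (hb : M.EntersWithoutHitting b) (hosc : M.Oscillating)
    {x : ℝ} (hx : b < x) (n : ℕ) : ∀ᵐ ω ∂M.P x,
      upTime (M.X · ω) b n ≠ ⊤ ∧ b < M.X (upTime (M.X · ω) b n).untopA ω ∧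
      entry (M.X · ω) (Iio b) (upTime (M.X · ω) b n) ≠ ⊤ ∧
      M.X (entry (M.X · ω) (Iio b) (upTime (M.X · ω) b n)).untopA ω < b := by
  -- The two claims feed each other: strictly above `b` at an upcrossing yields strictly below at
  -- the next downcrossing, and conversely.
  have down : ∀ n, (∀ᵐ ω ∂M.P x, b < M.X (upTime (M.X · ω) b n).untopA ω) → ∀ᵐ ω ∂M.P x,
      M.X (entry (M.X · ω) (Iio b) (upTime (M.X · ω) b n)).untopA ω < b := by
    intro n h
    filter_upwards [hosc.ae_exists x, ae_apply_entry_mem (M.isStoppingTime_upTime b n) isOpen_Iio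
      (h.mono fun ω hω _ => hb.ae_entersIn_Iio hω.ne')] with ω h1 h2
    have h3 := upTime_ne_top (fun T => (h1 T b).1) (fun T => (h1 T b).2) n
    exact h2 h3 (entry_ne_top_of_forall (fun T => (h1 T b).2) h3)
  have up : ∀ n, ∀ᵐ ω ∂M.P x, b < M.X (upTime (M.X · ω) b n).untopA ω := by
    intro n
    induction n with
    | zero =>
      filter_upwards [M.start x] with ω hω
      change b < M.X 0 ω
      rwa [hω]
    | succ n ih =>
      filter_upwards [hosc.ae_exists x, ae_apply_entry_mem
        (M.isStoppingTime_entry isOpen_Iio (M.isStoppingTime_upTime b n)) isOpen_Ioi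
        ((down n ih).mono fun ω hω _ => hb.ae_entersIn_Ioi hω)] with ω h1 h2
      have h3 := upTime_ne_top (fun T => (h1 T b).1) (fun T => (h1 T b).2) n
      have h4 := upTime_ne_top (fun T => (h1 T b).1) (fun T => (h1 T b).2) (n + 1)
      exact h2 (entry_ne_top_of_forall (fun T => (h1 T b).2) h3) h4
  filter_upwards [hosc.ae_exists x, up n, down n (up n)] with ω h1 h2 h3
  have h4 := upTime_ne_top (fun T => (h1 T b).1) (fun T => (h1 T b).2) n
  exact ⟨h4, h2, entry_ne_top_of_forall (fun T => (h1 T b).2) h4, h3⟩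

/-! ### The contraction argument -/

lemma measurableSet_overshootsIn_visitsOften {V U : Set ℝ} (hV : MeasurableSet V)
    (hU : MeasurableSet U) : MeasurableSet[pathSigma M.X]
      {ω | OvershootsIn b V (M.X · ω) ∧ VisitsOften U (M.X · ω)} :=
  (measurableSet_overshootsIn M.measurable_X_pathSigma M.rightCts hV).inter
    (measurableSet_visitsOften M.measurable_X_pathSigma hU)

/-- If `U j` increases, a bound for the probability from the points of the closures of the `U j`
holds from all points. -/
lemma measure_overshootsIn_visitsOften_le {V : Set ℝ} (hV : MeasurableSet V) {U : ℕ → Set ℝ}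
    (hU : ∀ j, IsOpen (U j)) (hmono : Monotone U) {s : ℝ≥0∞}
    (hs : ∀ j, ∀ y ∈ closure (U j),
      M.P y {ω | OvershootsIn b V (M.X · ω) ∧ VisitsOften (⋃ j, U j) (M.X · ω)} ≤ s) (z : ℝ) :
    M.P z {ω | OvershootsIn b V (M.X · ω) ∧ VisitsOften (⋃ j, U j) (M.X · ω)} ≤ s := by
  have hp := measurableSet_overshootsIn_visitsOften (M := M) (b := b) hV
    (isOpen_iUnion hU).measurableSet
  -- The entry is into a single `U j`, followed by continuity from below: at the entry into the
  -- union, the value could be a point of its closure that is in no `closure (U j)`, such as `b`.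
  have hmon : Monotone fun j => {ω | OvershootsIn b V (M.X · ω) ∧
      VisitsOften (⋃ j, U j) (M.X · ω)} ∩ {ω | entry (M.X · ω) (U j) 0 ≠ ⊤} := fun i j hij ω hω =>
    ⟨hω.1, ne_top_of_le_ne_top hω.2 (entry_anti (hmono hij))⟩
  have hsub : {ω | OvershootsIn b V (M.X · ω) ∧ VisitsOften (⋃ j, U j) (M.X · ω)} ⊆
      ⋃ j, {ω | OvershootsIn b V (M.X · ω) ∧ VisitsOften (⋃ j, U j) (M.X · ω)} ∩
        {ω | entry (M.X · ω) (U j) 0 ≠ ⊤} := by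
    intro ω hω
    obtain ⟨n, -, hn⟩ := hω.2 0
    obtain ⟨j, hj⟩ := mem_iUnion.1 hn
    exact mem_iUnion.2 ⟨j, hω, entry_ne_top ⟨_, bot_le, hj⟩⟩
  refine (measure_mono hsub).trans ?_
  rw [hmon.measure_iUnion]
  refine iSup_le fun j => ?_
  have hτ := M.isStoppingTime_entry (hU j) (isStoppingTime_const M.𝓕 0)
  calc _ ≤ M.P z {ω | entry (M.X · ω) (U j) 0 ≠ ⊤ ∧
          (OvershootsIn b V (shiftPath (entry (M.X · ω) (U j) 0).untopA (M.X · ω)) ∧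
            VisitsOften (⋃ j, U j) (shiftPath (entry (M.X · ω) (U j) 0).untopA (M.X · ω)))} :=
        measure_mono fun ω hω => ⟨hω.2, (M.rightCts ω).overshootsIn_shiftPath hω.1.1 _,
          (M.rightCts ω).visitsOften_shiftPath (isOpen_iUnion hU) hω.1.2 _⟩
    _ = ∫⁻ ω in {ω | entry (M.X · ω) (U j) 0 ≠ ⊤}, M.P (M.X (entry (M.X · ω) (U j) 0).untopA ω)
          {ω | OvershootsIn b V (M.X · ω) ∧ VisitsOften (⋃ j, U j) (M.X · ω)} ∂M.P z :=
        M.measure_shiftPath (p := fun f => OvershootsIn b V f ∧ VisitsOften (⋃ j, U j) f) hτ hp z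
    _ ≤ ∫⁻ ω in {ω | entry (M.X · ω) (U j) 0 ≠ ⊤}, s ∂M.P z :=
        setLIntegral_mono' hτ.measurableSet_eq_top.compl fun ω hω =>
          hs j _ ((M.rightCts ω).mem_closure_of_entry (coe_untopA hω).symm)
    _ ≤ s := by
        rw [setLIntegral_const]
        exact mul_le_of_le_one_right' prob_le_one

/-- One overshoot costs a factor, the probability that it is in `V`. -/
lemma measure_overshootsIn_visitsOften_le_mul (hb : M.EntersWithoutHitting b)
    (hosc : M.Oscillating) {V U : Set ℝ} (hV : MeasurableSet V) (hU : IsOpen U) {s : ℝ≥0∞}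
    (hs : ∀ z, M.P z {ω | OvershootsIn b V (M.X · ω) ∧ VisitsOften U (M.X · ω)} ≤ s)
    {y : ℝ} (hy : y ≠ b) :
    M.P y {ω | OvershootsIn b V (M.X · ω) ∧ VisitsOften U (M.X · ω)} ≤
      s * M.P y {ω | M.σ b 1 ω ≠ ⊤ ∧ stoppedValue M.X (M.σ b 1) ω ∈ V} := by
  have hp := measurableSet_overshootsIn_visitsOften (M := M) (b := b) hV hU.measurableSet
  -- Adding `M.X 0 ω ∈ V` to the event makes the integrand below vanish where the overshoot is
  -- outside `V`.
  have hq : MeasurableSet[pathSigma M.X] {ω | M.X 0 ω ∈ V ∧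
      OvershootsIn b V (M.X · ω) ∧ VisitsOften U (M.X · ω)} :=
    MeasurableSet.inter (M.measurable_X_pathSigma 0 hV) hp
  have hτ := M.isStoppingTime_upTime b 1
  have hτm : MeasurableSet {ω | upTime (M.X · ω) b 1 ≠ ⊤} := hτ.measurableSet_eq_top.compl
  have hB : MeasurableSet {ω | M.X (upTime (M.X · ω) b 1).untopA ω ∈ V} :=
    measurable_apply_untopA M.measurable_X M.rightCts
      (measurable_upTime M.measurable_X M.rightCts b 1) hV
  calc _ ≤ M.P y {ω | upTime (M.X · ω) b 1 ≠ ⊤ ∧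
          (shiftPath (upTime (M.X · ω) b 1).untopA (M.X · ω) 0 ∈ V ∧
          OvershootsIn b V (shiftPath (upTime (M.X · ω) b 1).untopA (M.X · ω)) ∧
            VisitsOften U (shiftPath (upTime (M.X · ω) b 1).untopA (M.X · ω)))} := by
        refine measure_mono_ae ?_
        filter_upwards [hosc.ae_exists y, hb.ae_entersIn_Iio hy] with ω h1 h2 hω
        have h3 : entry (M.X · ω) (Iio b) 0 ≠ ⊤ :=
          entry_ne_top_of_forall (fun T => (h1 T b).2) (WithTop.coe_ne_top (a := 0))
        -- Since `y ≠ b`, the path is strictly below `b` at the first downcrossing, so the overshoot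
        -- condition applies from that time.
        obtain ⟨u, h4, h5⟩ := (M.rightCts ω).overshootsIn_iff.1 hω.1
          (entry (M.X · ω) (Iio b) 0).untopA (h2.resolve_left h3)
        rw [coe_untopA h3] at h4
        have h6 : upTime (M.X · ω) b 1 = u := h4
        refine ⟨by rw [h6]; exact WithTop.coe_ne_top, ?_,
          (M.rightCts ω).overshootsIn_shiftPath hω.1 _,
          (M.rightCts ω).visitsOften_shiftPath hU hω.2 _⟩
        rw [h6]
        change M.X (u + 0) ω ∈ V
        rwa [add_zero]
    _ = ∫⁻ ω in {ω | upTime (M.X · ω) b 1 ≠ ⊤}, M.P (M.X (upTime (M.X · ω) b 1).untopA ω)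
          {ω | M.X 0 ω ∈ V ∧ OvershootsIn b V (M.X · ω) ∧ VisitsOften U (M.X · ω)} ∂M.P y :=
        M.measure_shiftPath (p := fun f => f 0 ∈ V ∧ OvershootsIn b V f ∧ VisitsOften U f) hτ hq y
    _ ≤ ∫⁻ ω in {ω | upTime (M.X · ω) b 1 ≠ ⊤},
          {ω | M.X (upTime (M.X · ω) b 1).untopA ω ∈ V}.indicator (fun _ => s) ω ∂M.P y := by
        refine lintegral_mono fun ω => ?_
        by_cases h : M.X (upTime (M.X · ω) b 1).untopA ω ∈ V
        · rw [indicator_of_mem (by exact h)]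
          exact (measure_mono fun ω hω => hω.2).trans (hs _)
        · rw [indicator_of_notMem (by exact h)]
          refine le_of_eq (measure_eq_zero_iff_ae_notMem.2 ?_)
          filter_upwards [M.start (M.X (upTime (M.X · ω) b 1).untopA ω)] with ω' hω' h1
          exact h (hω' ▸ h1.1)
    _ = s * M.P y {ω | M.σ b 1 ω ≠ ⊤ ∧ stoppedValue M.X (M.σ b 1) ω ∈ V} := by
        rw [setLIntegral_indicator hB, setLIntegral_const]
        congr 2
        ext ω
        simp [stoppedValue, sigma_eq_upTime, and_comm]

/-- If the overshoot is in `V` with probability at most `c < 1` from all points of the closures of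
the `U j`, then a.s. not all overshoots are in `V` while the path visits the union of the `U j` at
arbitrarily large times. -/
theorem measure_overshootsIn_visitsOften_eq_zero (hb : M.EntersWithoutHitting b)
    (hosc : M.Oscillating) {V : Set ℝ} (hV : MeasurableSet V) {U : ℕ → Set ℝ}
    (hU : ∀ j, IsOpen (U j)) (hmono : Monotone U) {c : ℝ≥0∞} (hc : c < 1)
    (h : ∀ j, ∀ y ∈ closure (U j), y ≠ b ∧
      M.P y {ω | M.σ b 1 ω ≠ ⊤ ∧ stoppedValue M.X (M.σ b 1) ω ∈ V} ≤ c) (x : ℝ) :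
    M.P x {ω | OvershootsIn b V (M.X · ω) ∧ VisitsOften (⋃ j, U j) (M.X · ω)} = 0 := by
  set s := ⨆ j, ⨆ y ∈ closure (U j),
    M.P y {ω | OvershootsIn b V (M.X · ω) ∧ VisitsOften (⋃ j, U j) (M.X · ω)} with hsdef
  have hs : ∀ z, M.P z {ω | OvershootsIn b V (M.X · ω) ∧ VisitsOften (⋃ j, U j) (M.X · ω)} ≤ s :=
    measure_overshootsIn_visitsOften_le hV hU hmono fun j y hy =>
      le_iSup_of_le j (le_iSup₂_of_le y hy le_rfl)
  have hs1 : s ≤ 1 := iSup_le fun j => iSup₂_le fun y hy => prob_le_one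
  have hsc : s ≤ s * c := iSup_le fun j => iSup₂_le fun y hy =>
    (measure_overshootsIn_visitsOften_le_mul hb hosc hV (isOpen_iUnion hU) hs (h j y hy).1).trans
      (by gcongr; exact (h j y hy).2)
  -- A finite `s` with `s ≤ s * c` and `c < 1` must vanish.
  have hs0 : s = 0 := by
    by_contra hne
    have : s * c < s * 1 := (ENNReal.mul_lt_mul_iff_right hne (hs1.trans_lt ENNReal.one_lt_top).ne).2 hc
    rw [mul_one] at this
    exact hsc.not_gt this
  exact le_antisymm (hs0 ▸ hs x) bot_le

end StrongMarkovProcess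

/-! ### Recurrence and transience -/

lemma liminf_coe_eq_zero_iff {g : ℝ≥0 → ℝ} (hg : ∀ t, 0 ≤ g t) :
    liminf (fun t => (g t : EReal)) atTop = 0 ↔
      ∀ ε : ℝ, 0 < ε → ∀ T : ℝ≥0, ∃ t, T ≤ t ∧ g t < ε := by
  constructor
  · intro h ε hε T
    have h1 : liminf (fun t => (g t : EReal)) atTop < ε := h ▸ EReal.coe_pos.2 hε
    obtain ⟨t, h2, h3⟩ :=
      frequently_atTop.1 (frequently_lt_of_liminf_lt (by isBoundedDefault) h1) T
    exact ⟨t, h2, by exact_mod_cast h3⟩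
  · intro h
    refine le_antisymm (le_of_forall_gt_imp_ge_of_dense fun c hc => ?_)
      (le_liminf_of_le (by isBoundedDefault) (Eventually.of_forall fun t =>
        EReal.coe_nonneg.2 (hg t)))
    obtain ⟨ε, h1, h2⟩ := EReal.lt_iff_exists_real_btwn.1 hc
    refine (liminf_le_of_frequently_le' (frequently_atTop.2 fun T => ?_)).trans h2.le
    obtain ⟨t, h3, h4⟩ := h ε (EReal.coe_pos.1 h1) T
    exact ⟨t, h3, EReal.coe_le_coe h4.le⟩

lemma RightCts.liminf_abs_sub_eq_zero_iff {f : ℝ≥0 → ℝ} (hf : RightCts f) (b : ℝ) :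
    liminf (fun t => ((|f t - b| : ℝ) : EReal)) atTop = 0 ↔
      ∀ k : ℕ, VisitsOften (Metric.ball b (1 / (k + 1))) f := by
  rw [liminf_coe_eq_zero_iff fun t => abs_nonneg _]
  simp_rw [hf.visitsOften_iff Metric.isOpen_ball, Metric.mem_ball, Real.dist_eq]
  refine ⟨fun h k => h _ (by positivity), fun h ε hε T => ?_⟩
  obtain ⟨k, hk⟩ := exists_nat_one_div_lt hε
  obtain ⟨t, h1, h2⟩ := h k T
  exact ⟨t, h1, h2.trans hk⟩

lemma exists_abs_sub_lt_of_liminf {y : ℕ → ℝ} {b : ℝ}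
    (h : liminf (fun n => (y n : EReal)) atTop = b) {ε : ℝ} (hε : 0 < ε) : ∃ n, |y n - b| < ε := by
  have h1 : ((b - ε : ℝ) : EReal) < liminf (fun n => (y n : EReal)) atTop :=
    h ▸ EReal.coe_lt_coe (by linarith)
  have h2 : liminf (fun n => (y n : EReal)) atTop < ((b + ε : ℝ) : EReal) :=
    h ▸ EReal.coe_lt_coe (by linarith)
  obtain ⟨n, h3, h4⟩ := ((frequently_lt_of_liminf_lt (by isBoundedDefault) h2).and_eventually
    (eventually_lt_of_lt_liminf h1 (by isBoundedDefault))).exists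
  have h3 : y n < b + ε := by exact_mod_cast h3
  have h4 : b - ε < y n := by exact_mod_cast h4
  exact ⟨n, abs_lt.2 ⟨by linarith, by linarith⟩⟩

/-- With `S` the supremum of the times: either it is never reached and the limit is the left limit
at `S`, or the times are eventually equal to `S`. -/
lemma IsCadlag.exists_tendsto_comp {f : ℝ≥0 → ℝ} (hf : IsCadlag f) {u : ℕ → ℝ≥0} (hu : Monotone u)
    (hbdd : BddAbove (range u)) : ∃ l S, (∀ n, u n ≤ S) ∧ Tendsto (fun n => f (u n)) atTop (𝓝 l) ∧
      ((∀ n, u n ≠ S) → Tendsto f (𝓝[<] S) (𝓝 l)) := by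
  have hle : ∀ n, u n ≤ ⨆ n, u n := le_ciSup hbdd
  by_cases h : ∀ n, u n ≠ ⨆ n, u n
  · obtain ⟨l, hl⟩ := hf.2 (⨆ n, u n)
    refine ⟨l, _, hle, hl.comp (tendsto_nhdsWithin_iff.2 ⟨tendsto_atTop_ciSup hu hbdd, ?_⟩),
      fun _ => hl⟩
    exact Eventually.of_forall fun n => lt_of_le_of_ne (hle n) (h n)
  · push Not at h
    obtain ⟨n, hn⟩ := h
    refine ⟨f (⨆ n, u n), _, hle, ?_, fun h => absurd hn (h n)⟩
    refine tendsto_const_nhds.congr' ((eventually_ge_atTop n).mono fun k hk => ?_)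
    have hk' : u k = ⨆ n, u n := le_antisymm (hle k) (hn ▸ hu hk)
    simp only [hk']

lemma exists_lt_upTime_of_tendsto_atTop {f : ℝ≥0 → ℝ} (hf : IsCadlag f) {b : ℝ}
    (hfin : ∀ n, upTime f b n ≠ ⊤)
    (h : Tendsto (fun n => f (upTime f b n).untopA) atTop atTop) (T : ℝ≥0) :
    ∃ n, (T : WithTop ℝ≥0) < upTime f b n := by
  by_contra! hT
  obtain ⟨l, S, -, h1, -⟩ := hf.exists_tendsto_comp (u := fun n => (upTime f b n).untopA)
    (fun i j hij => by
      have := monotone_upTime (f := f) (b := b) hij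
      rw [← coe_untopA (hfin i), ← coe_untopA (hfin j)] at this
      exact_mod_cast this)
    ⟨T, by
      rintro _ ⟨n, rfl⟩
      have := hT n
      rw [← coe_untopA (hfin n)] at this
      exact_mod_cast this⟩
  exact not_tendsto_nhds_of_tendsto_atTop h l h1

/-- If the upcrossing times are bounded and the overshoots tend to `b`, then the left limit of the
path at the supremum of the upcrossing times is `b`. -/
lemma exists_leftLimit_of_upTime_le {f : ℝ≥0 → ℝ} (hf : IsCadlag f) {b : ℝ} {T : ℝ≥0}
    (hT : ∀ n, upTime f b n ≤ T) (hgt : ∀ n, b < f (upTime f b n).untopA)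
    (h : Tendsto (fun n => f (upTime f b n).untopA) atTop (𝓝 b)) :
    ∃ t, 0 < t ∧ Tendsto f (𝓝[<] t) (𝓝 b) := by
  have hfin : ∀ n, upTime f b n ≠ ⊤ := fun n => ne_top_of_le_ne_top WithTop.coe_ne_top (hT n)
  obtain ⟨l, S, h1, h2, h3⟩ := hf.exists_tendsto_comp (u := fun n => (upTime f b n).untopA)
    (fun i j hij => by
      have := monotone_upTime (f := f) (b := b) hij
      rw [← coe_untopA (hfin i), ← coe_untopA (hfin j)] at this
      exact_mod_cast this)
    ⟨T, by
      rintro _ ⟨n, rfl⟩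
      have := hT n
      rw [← coe_untopA (hfin n)] at this
      exact_mod_cast this⟩
  -- The path stays above `b` for a while after an upcrossing, so the crossing times never reach
  -- their supremum.
  have hlt : ∀ n, (upTime f b n).untopA < (upTime f b (n + 1)).untopA := by
    intro n
    obtain ⟨v, h4, h5⟩ := RightCts.exists_Ico hf.1 isOpen_Ioi (hgt n)
    refine h4.trans_le ?_
    have h6 : (v : WithTop ℝ≥0) ≤ upTime f b (n + 1) := by
      refine le_trans (le_sInf ?_) le_entry
      rintro _ ⟨w, ⟨h6, h7⟩, rfl⟩
      rw [← coe_untopA (hfin n)] at h6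
      by_contra! h8
      exact lt_asymm (mem_Ioi.1 (h5 w ⟨by exact_mod_cast h6, by exact_mod_cast h8⟩)) h7
    rw [← coe_untopA (hfin (n + 1))] at h6
    exact_mod_cast h6
  have hne : ∀ n, (upTime f b n).untopA ≠ S := fun n hn => ((hlt n).trans_le (h1 (n + 1))).ne hn
  refine ⟨S, bot_le.trans_lt ((hlt 0).trans_le (h1 1)), ?_⟩
  rw [← tendsto_nhds_unique h2 h]
  exact h3 hne

lemma tendsto_nhdsLT_of_shiftPath {f : ℝ≥0 → ℝ} {s t : ℝ≥0} {l : ℝ} (ht : 0 < t)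
    (h : Tendsto (shiftPath s f) (𝓝[<] t) (𝓝 l)) : Tendsto f (𝓝[<] (s + t)) (𝓝 l) := by
  have h1 : Tendsto (fun u : ℝ≥0 => u - s) (𝓝[<] (s + t)) (𝓝[<] t) := by
    refine tendsto_nhdsWithin_iff.2 ⟨?_, ?_⟩
    · have : Tendsto (fun u : ℝ≥0 => u - s) (𝓝 (s + t)) (𝓝 (s + t - s)) :=
        (continuous_id.sub continuous_const).tendsto _
      rw [add_tsub_cancel_left] at this
      exact this.mono_left nhdsWithin_le_nhds
    · filter_upwards [self_mem_nhdsWithin] with u hu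
      rw [mem_Iio] at hu ⊢
      rcases le_total s u with h2 | h2
      · exact (tsub_lt_iff_left h2).2 hu
      · rwa [tsub_eq_zero_of_le h2]
  refine (h.comp h1).congr' ?_
  filter_upwards [mem_nhdsWithin_of_mem_nhds (Ioi_mem_nhds (show s < s + t from
    lt_add_of_pos_right s ht))] with u hu
  simp [shiftPath, add_tsub_cancel_of_le (mem_Ioi.1 hu).le]

lemma IsCadlag.shift {f : ℝ≥0 → ℝ} (hf : IsCadlag f) (s : ℝ≥0) : IsCadlag (shiftPath s f) := by
  refine ⟨RightCts.shift hf.1 s, fun t => ?_⟩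
  obtain ⟨l, hl⟩ := hf.2 (s + t)
  refine ⟨l, hl.comp (tendsto_nhdsWithin_iff.2 ⟨?_, ?_⟩)⟩
  · exact ((continuous_const.add continuous_id).tendsto t).mono_left nhdsWithin_le_nhds
  · filter_upwards [self_mem_nhdsWithin] with u hu
    exact add_lt_add_right (mem_Iio.1 hu) s

section

variable {Ω : Type*} {m : MeasurableSpace Ω} {X : ℝ≥0 → Ω → ℝ}

lemma measurableSet_exists_dseq_mem (hX : ∀ t, Measurable (X t)) {U : Set ℝ}
    (hU : MeasurableSet U) : MeasurableSet {ω | ∃ n, X (dseq n) ω ∈ U} :=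
  measurableSet_setOfPred.2 (Measurable.exists fun _ => measurableSet_setOfPred.1 (hX _ hU))

lemma measurableSet_forall_visitsOften (hX : ∀ t, Measurable (X t)) {U : ℕ → Set ℝ}
    (hU : ∀ k, MeasurableSet (U k)) : MeasurableSet {ω | ∀ k, VisitsOften (U k) (X · ω)} :=
  measurableSet_setOfPred.2 (Measurable.forall fun k =>
    measurableSet_setOfPred.1 (measurableSet_visitsOften hX (hU k)))

lemma measurableSet_upTime_bounded_tendsto (hX : ∀ t, Measurable (X t))
    (hc : ∀ ω, RightCts (X · ω)) {b : ℝ} : MeasurableSet {ω |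
      (∃ K : ℕ, ∀ n, upTime (X · ω) b n ≤ ((K : ℝ≥0) : WithTop ℝ≥0)) ∧
      (∀ n, b < X (upTime (X · ω) b n).untopA ω) ∧
      Tendsto (fun n => X (upTime (X · ω) b n).untopA ω) atTop (𝓝 b)} := by
  have hm := measurable_upTime hX hc b
  have hm' := fun n => measurable_apply_untopA hX hc (hm n)
  refine MeasurableSet.inter ?_ (MeasurableSet.inter ?_ ?_)
  · exact measurableSet_setOfPred.2 (Measurable.exists fun K => Measurable.forall fun n =>
      measurableSet_setOfPred.1 (measurableSet_le (hm n) measurable_const))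
  · exact measurableSet_setOfPred.2 (Measurable.forall fun n =>
      measurableSet_setOfPred.1 (measurableSet_lt measurable_const (hm' n)))
  · exact measurableSet_tendsto _ hm'

end

namespace StrongMarkovProcess

variable {Ω : Type*} [MeasurableSpace Ω] {M : StrongMarkovProcess Ω} {b : ℝ}

/-- A path event which is almost sure from all points above `b` almost surely takes place for the
path after some time larger than a given one. -/
lemma Oscillating.ae_exists_shiftPath (hosc : M.Oscillating) {p : (ℝ≥0 → ℝ) → Prop}
    (hp : MeasurableSet[pathSigma M.X] {ω | p (M.X · ω)})
    (h : ∀ x, b < x → ∀ᵐ ω ∂M.P x, p (M.X · ω)) (z : ℝ) (T : ℝ≥0) :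
    ∀ᵐ ω ∂M.P z, ∃ t, T ≤ t ∧ p (shiftPath t (M.X · ω)) := by
  -- The level `b + 1` leaves room: at the entry only `b + 1 ≤ X` is known, which is still strictly
  -- above `b`.
  have hτ := M.isStoppingTime_entry (isOpen_Ioi (a := b + 1)) (isStoppingTime_const M.𝓕 T)
  have h1 := M.ae_shiftPath hτ hp (x := z) (Eventually.of_forall fun ω hω => h _ (by
    have := (M.rightCts ω).mem_closure_of_entry (coe_untopA hω).symm
    rw [closure_Ioi, mem_Ici] at this
    linarith))
  filter_upwards [h1, hosc.ae_exists z] with ω h2 h3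
  have h4 : entry (M.X · ω) (Ioi (b + 1)) T ≠ ⊤ :=
    entry_ne_top_of_forall (fun S => (h3 S (b + 1)).1) WithTop.coe_ne_top
  refine ⟨_, ?_, h2 h4⟩
  have h5 := le_entry (f := (M.X · ω)) (A := Ioi (b + 1)) (t := T)
  rw [← coe_untopA h4] at h5
  exact_mod_cast h5

/-! ### The three conclusions -/

theorem locallyRecurrent_of_liminf (hosc : M.Oscillating)
    (h : ∀ x, b < x → ∀ᵐ ω ∂M.P x, liminf (fun n => (M.Y b n ω : EReal)) atTop = b) :
    M.LocallyRecurrent b := by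
  have key : ∀ k N : ℕ, ∀ᵐ ω ∂M.P b, ∃ t : ℝ≥0, (N : ℝ≥0) ≤ t ∧
      ∃ n, shiftPath t (M.X · ω) (dseq n) ∈ Metric.ball b (1 / (k + 1)) := by
    intro k N
    refine hosc.ae_exists_shiftPath (b := b)
      (p := fun f => ∃ n, f (dseq n) ∈ Metric.ball b (1 / (k + 1))) ?_ (fun x hx => ?_) b N
    · exact measurableSet_exists_dseq_mem M.measurable_X_pathSigma measurableSet_ball
    · filter_upwards [h x hx] with ω hω
      obtain ⟨n, hn⟩ := exists_abs_sub_lt_of_liminf hω (Nat.one_div_pos_of_nat (n := k))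
      obtain ⟨i, -, -, hi⟩ := (M.rightCts ω).exists_dseq (A := Metric.ball b (1 / (k + 1)))
        Metric.isOpen_ball (u := (M.σ b n ω).untopA) hn (lt_add_one _)
      exact ⟨i, hi⟩
  filter_upwards [ae_all_iff.2 fun k => ae_all_iff.2 (key k)] with ω hω
  rw [(M.rightCts ω).liminf_abs_sub_eq_zero_iff]
  intro k
  rw [(M.rightCts ω).visitsOften_iff Metric.isOpen_ball]
  intro T
  obtain ⟨N, hN⟩ := exists_nat_ge T
  obtain ⟨t, h1, n, h2⟩ := hω k N
  exact ⟨t + dseq n, hN.trans (h1.trans le_self_add), h2⟩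

theorem leftLimitRecurrent_of_tendsto (hosc : M.Oscillating) (hb : M.EntersWithoutHitting b)
    (h : ∀ x, b < x → ∀ᵐ ω ∂M.P x, Tendsto (fun n => M.Y b n ω) atTop (𝓝 b))
    {r R : ℝ} (hr : 0 < r) (hR : 0 < R) {c : ℝ≥0∞} (hc : c < 1)
    (hV : ∀ y ∈ Ici (b + r),
      M.P y {ω | M.σ b 1 ω ≠ ⊤ ∧ stoppedValue M.X (M.σ b 1) ω < b + R} ≤ c) :
    M.LeftLimitRecurrent b := by
  have hzero := measure_overshootsIn_visitsOften_eq_zero hb hosc (measurableSet_Iio (a := b + R))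
    (U := fun _ => Ioi (b + r)) (fun _ => isOpen_Ioi) monotone_const hc fun _ y hy => by
      rw [closure_Ioi] at hy
      exact ⟨by rw [mem_Ici] at hy; linarith, hV y hy⟩
  rw [iUnion_const] at hzero
  have key : ∀ N : ℕ, ∀ᵐ ω ∂M.P b, ∃ t : ℝ≥0, (N : ℝ≥0) ≤ t ∧
      (∃ K : ℕ, ∀ n, upTime (shiftPath t (M.X · ω)) b n ≤ ((K : ℝ≥0) : WithTop ℝ≥0)) ∧
      (∀ n, b < shiftPath t (M.X · ω) (upTime (shiftPath t (M.X · ω)) b n).untopA) ∧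
      Tendsto (fun n => shiftPath t (M.X · ω) (upTime (shiftPath t (M.X · ω)) b n).untopA)
        atTop (𝓝 b) := by
    intro N
    refine hosc.ae_exists_shiftPath (b := b)
      (p := fun f => (∃ K : ℕ, ∀ n, upTime f b n ≤ ((K : ℝ≥0) : WithTop ℝ≥0)) ∧
        (∀ n, b < f (upTime f b n).untopA) ∧
        Tendsto (fun n => f (upTime f b n).untopA) atTop (𝓝 b)) ?_ (fun x hx => ?_) b N
    · exact measurableSet_upTime_bounded_tendsto M.measurable_X_pathSigma M.rightCts
    -- The index from which the overshoots stay below `b + R` depends on `ω`, so the null event is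
    -- excluded after every upcrossing time.
    · have hG : ∀ n, ∀ᵐ ω ∂M.P x, upTime (M.X · ω) b n ≠ ⊤ →
          ¬ (OvershootsIn b (Iio (b + R)) (shiftPath (upTime (M.X · ω) b n).untopA (M.X · ω)) ∧
            VisitsOften (Ioi (b + r)) (shiftPath (upTime (M.X · ω) b n).untopA (M.X · ω))) :=
        fun n => M.ae_shiftPath (M.isStoppingTime_upTime b n)
          (p := fun f => ¬ (OvershootsIn b (Iio (b + R)) f ∧ VisitsOften (Ioi (b + r)) f))
          (measurableSet_overshootsIn_visitsOften measurableSet_Iio measurableSet_Ioi).compl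
          (Eventually.of_forall fun ω _ => measure_eq_zero_iff_ae_notMem.1 (hzero _))
      filter_upwards [h x hx, ae_all_iff.2 (hb.ae_crossing hosc hx), ae_all_iff.2 hG,
        hosc.ae_exists x] with ω h1 h2 h3 h4
      simp only [Y, stoppedValue, sigma_eq_upTime] at h1
      refine ⟨?_, fun n => (h2 n).2.1, h1⟩
      by_contra! hub
      obtain ⟨m, hm⟩ := eventually_atTop.1 (h1.eventually (Iio_mem_nhds (lt_add_of_pos_right b hR)))
      refine h3 m (h2 m).1 ⟨(M.rightCts ω).overshootsIn_of_upTime (fun T => ?_)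
        (fun n => (h2 n).1) hm (coe_untopA (h2 m).1).symm, ?_⟩
      · obtain ⟨K, hK⟩ := exists_nat_ge T
        obtain ⟨n, hn⟩ := hub K
        exact ⟨n, (WithTop.coe_le_coe.2 hK).trans_lt hn⟩
      · refine (M.rightCts ω).visitsOften_shiftPath isOpen_Ioi ?_ _
        exact ((M.rightCts ω).visitsOften_iff isOpen_Ioi).2 fun T => (h4 T _).1
  filter_upwards [ae_all_iff.2 key] with ω hω T hT
  obtain ⟨N, hN⟩ := exists_nat_ge T
  obtain ⟨s, h1, ⟨K, hK⟩, h2, h3⟩ := hω N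
  obtain ⟨t, h4, h5⟩ := exists_leftLimit_of_upTime_le (IsCadlag.shift (M.cadlag ω) s) hK h2 h3
  exact ⟨s + t, (hN.trans h1).trans_lt (lt_add_of_pos_right s h4), tendsto_nhdsLT_of_shiftPath h4 h5⟩

theorem locallyTransient_of_tendsto (hosc : M.Oscillating) (hb : M.EntersWithoutHitting b)
    (h : ∀ x, b < x → ∀ᵐ ω ∂M.P x, Tendsto (fun n => M.Y b n ω) atTop atTop)
    {r R : ℝ} (hr : 0 < r) {c : ℝ≥0∞} (hc : c < 1)
    (hV : ∀ y ∈ Icc (b - r) (b + r) \ {b},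
      M.P y {ω | M.σ b 1 ω ≠ ⊤ ∧ b + R < stoppedValue M.X (M.σ b 1) ω} ≤ c) :
    M.LocallyTransient b := by
  -- Annuli whose closures avoid `b` and which exhaust the punctured ball of radius `r`.
  set U : ℕ → Set ℝ := fun j => {x | r / (j + 2) < |x - b| ∧ |x - b| < r} with hUdef
  have hcont : Continuous fun x => |x - b| := by fun_prop
  have hU : ∀ j, IsOpen (U j) := fun j =>
    (isOpen_Ioo (a := r / (j + 2)) (b := r)).preimage hcont
  have hmono : Monotone U := fun i j hij x hx =>
    ⟨lt_of_le_of_lt (by gcongr) hx.1, hx.2⟩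
  have hcl : ∀ j, closure (U j) ⊆ {x | r / (j + 2) ≤ |x - b| ∧ |x - b| ≤ r} := fun j =>
    closure_minimal (fun x hx => ⟨hx.1.le, hx.2.le⟩)
      ((isClosed_Icc (a := r / (j + 2)) (b := r)).preimage hcont)
  have hzero := measure_overshootsIn_visitsOften_eq_zero hb hosc (measurableSet_Ioi (a := b + R))
    hU hmono hc fun j y hy => by
      obtain ⟨h1, h2⟩ := hcl j hy
      have h3 : y ≠ b := by
        rintro rfl
        have : 0 < r / (j + 2 : ℝ) := by positivity
        simp at h1
        linarith
      rw [abs_le] at h2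
      exact ⟨h3, hV y ⟨⟨by linarith, by linarith⟩, h3⟩⟩
  have hmemU : ∀ x, x ≠ b → |x - b| < r → x ∈ ⋃ j, U j := by
    intro x hx hxr
    obtain ⟨j, hj⟩ := exists_nat_gt (r / |x - b|)
    have hpos : 0 < |x - b| := abs_pos.2 (sub_ne_zero.2 hx)
    refine mem_iUnion.2 ⟨j, ?_, hxr⟩
    rw [div_lt_iff₀ hpos] at hj
    rw [div_lt_iff₀ (by positivity)]
    nlinarith
  have habove : ∀ x, b < x → ∀ᵐ ω ∂M.P x,
      ¬ ∀ k : ℕ, VisitsOften (Metric.ball b (1 / (k + 1))) (M.X · ω) := by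
    intro x hx
    have hG : ∀ n, ∀ᵐ ω ∂M.P x, upTime (M.X · ω) b n ≠ ⊤ →
        ¬ (OvershootsIn b (Ioi (b + R)) (shiftPath (upTime (M.X · ω) b n).untopA (M.X · ω)) ∧
          VisitsOften (⋃ j, U j) (shiftPath (upTime (M.X · ω) b n).untopA (M.X · ω))) :=
      fun n => M.ae_shiftPath (M.isStoppingTime_upTime b n)
        (p := fun f => ¬ (OvershootsIn b (Ioi (b + R)) f ∧ VisitsOften (⋃ j, U j) f))
        (measurableSet_overshootsIn_visitsOften measurableSet_Ioi
          (isOpen_iUnion hU).measurableSet).compl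
        (Eventually.of_forall fun ω _ => measure_eq_zero_iff_ae_notMem.1 (hzero _))
    have hA : ∀ n, ∀ᵐ ω ∂M.P x, upTime (M.X · ω) b n ≠ ⊤ →
        AvoidsIn b (Ici b) (shiftPath (upTime (M.X · ω) b n).untopA (M.X · ω)) := fun n =>
      M.ae_shiftPath (M.isStoppingTime_upTime b n)
        (measurableSet_avoidsIn M.measurable_X_pathSigma measurableSet_Ici)
        ((hb.ae_crossing hosc hx n).mono fun ω hω _ => hb.ae_avoidsIn_Ici hω.2.1)
    have hB : ∀ n, ∀ᵐ ω ∂M.P x, entry (M.X · ω) (Iio b) (upTime (M.X · ω) b n) ≠ ⊤ →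
        AvoidsIn b (Iic b) (shiftPath (entry (M.X · ω) (Iio b) (upTime (M.X · ω) b n)).untopA
          (M.X · ω)) := fun n =>
      M.ae_shiftPath (M.isStoppingTime_entry isOpen_Iio (M.isStoppingTime_upTime b n))
        (measurableSet_avoidsIn M.measurable_X_pathSigma measurableSet_Iic)
        ((hb.ae_crossing hosc hx n).mono fun ω hω _ => hb.ae_avoidsIn_Iic hω.2.2.2)
    filter_upwards [h x hx, ae_all_iff.2 (hb.ae_crossing hosc hx), ae_all_iff.2 hG,
      ae_all_iff.2 hA, ae_all_iff.2 hB] with ω h1 h2 h3 h4 h5 hE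
    simp only [Y, stoppedValue, sigma_eq_upTime] at h1
    have hub := exists_lt_upTime_of_tendsto_atTop (M.cadlag ω) (fun n => (h2 n).1) h1
    obtain ⟨m, hm⟩ := eventually_atTop.1 (h1.eventually (Ioi_mem_atTop (b + R)))
    refine h3 m (h2 m).1 ⟨(M.rightCts ω).overshootsIn_of_upTime hub
      (fun n => (h2 n).1) hm (coe_untopA (h2 m).1).symm, ?_⟩
    refine (M.rightCts ω).visitsOften_shiftPath (isOpen_iUnion hU) ?_ _
    rw [(M.rightCts ω).visitsOften_iff (isOpen_iUnion hU)]
    -- Without visits to the punctured ball after `T`, a later visit to a smaller ball is at `b`,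
    -- and by right continuity the path then equals `b` on an interval.
    by_contra! hT
    obtain ⟨T, hT⟩ := hT
    obtain ⟨k, hk⟩ := exists_nat_one_div_lt hr
    obtain ⟨u, hTu, hu⟩ := ((M.rightCts ω).visitsOften_iff Metric.isOpen_ball).1 (hE k) T
    obtain ⟨v, huv, hv⟩ := (M.rightCts ω).exists_Ico Metric.isOpen_ball hu
    refine false_of_constant hub (fun n t ht => ?_) (fun n t ht => ?_) huv fun w hw => ?_
    · have := h4 n (h2 n).1
      rw [ht] at this
      exact this
    · have := h5 n (h2 n).2.2.1
      rw [ht] at this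
      exact this
    · by_contra hwb
      exact hT w (hTu.trans hw.1) (hmemU _ hwb ((Metric.mem_ball.1 (hv w hw)).trans hk))
  have hmeas : MeasurableSet[pathSigma M.X]
      {ω | ¬ ∀ k : ℕ, VisitsOften (Metric.ball b (1 / (k + 1))) (M.X · ω)} :=
    (measurableSet_forall_visitsOften M.measurable_X_pathSigma fun _ => measurableSet_ball).compl
  have hall := hosc.ae_exists_shiftPath (b := b)
    (p := fun f => ¬ ∀ k : ℕ, VisitsOften (Metric.ball b (1 / (k + 1))) f) hmeas habove b 0
  -- The probability is in fact zero: recurrence at `b` would pass to the path restarted above `b +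
  -- 1`.
  have : M.P b {ω | liminf (fun t => ((|M.X t ω - b| : ℝ) : EReal)) atTop = 0} = 0 := by
    refine measure_eq_zero_iff_ae_notMem.2 ?_
    filter_upwards [hall] with ω hω hlim
    obtain ⟨t, -, ht⟩ := hω
    exact ht fun k => (M.rightCts ω).visitsOften_shiftPath Metric.isOpen_ball
      (((M.rightCts ω).liminf_abs_sub_eq_zero_iff b).1 hlim k) t
  rw [LocallyTransient, this]
  exact one_pos

end StrongMarkovProcess

end Overshoot

end

theorem mainTheorem2 {Ω : Type*} [MeasurableSpace Ω] (M : Overshoot.StrongMarkovProcess Ω) (b : ℝ)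
    (hosc : M.Oscillating) (hb : M.EntersWithoutHitting b) :
    ((∀ x, b < x → ∀ᵐ ω ∂M.P x, Tendsto (fun n => M.Y b n ω) atTop atTop) →
      (∃ r > (0 : ℝ), ∃ R > (0 : ℝ), ∃ c < (1 : ℝ≥0∞),
        ⨆ y ∈ Icc (b - r) (b + r) \ {b},
          M.P y {ω | M.σ b 1 ω ≠ ⊤ ∧ b + R < stoppedValue M.X (M.σ b 1) ω} < c) →
      M.LocallyTransient b) ∧
    ((∀ x, b < x → ∀ᵐ ω ∂M.P x, liminf (fun n => (M.Y b n ω : EReal)) atTop = b) →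
      M.LocallyRecurrent b) ∧
    ((∀ x, b < x → ∀ᵐ ω ∂M.P x, Tendsto (fun n => M.Y b n ω) atTop (𝓝 b)) →
      (∃ r' > (0 : ℝ), ∃ R' > (0 : ℝ), ∃ c < (1 : ℝ≥0∞),
        ⨆ y ∈ Ici (b + r'),
          M.P y {ω | M.σ b 1 ω ≠ ⊤ ∧ stoppedValue M.X (M.σ b 1) ω < b + R'} < c) →
      M.LeftLimitRecurrent b) := by
  refine ⟨fun h hV => ?_, Overshoot.StrongMarkovProcess.locallyRecurrent_of_liminf hosc,
    fun h hV => ?_⟩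
  · obtain ⟨r, hr, R, -, c, hc, hlt⟩ := hV
    exact Overshoot.StrongMarkovProcess.locallyTransient_of_tendsto hosc hb h hr hc fun y hy =>
      (le_iSup₂ (f := fun y (_ : y ∈ Icc (b - r) (b + r) \ {b}) =>
        M.P y {ω | M.σ b 1 ω ≠ ⊤ ∧ b + R < stoppedValue M.X (M.σ b 1) ω}) y hy).trans hlt.le
  · obtain ⟨r, hr, R, hR, c, hc, hlt⟩ := hV
    exact Overshoot.StrongMarkovProcess.leftLimitRecurrent_of_tendsto hosc hb h hr hR hc fun y hy =>
      (le_iSup₂ (f := fun y (_ : y ∈ Ici (b + r)) =>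
        M.P y {ω | M.σ b 1 ω ≠ ⊤ ∧ stoppedValue M.X (M.σ b 1) ω < b + R}) y hy).trans hlt.le
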